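/- Let $k$ be a field of characteristic zero, let $p$ be a prime number, and let $B=k[U,V,W]$ be the polynomial ring in three variables with its standard grading $B=\bigoplus_i B_i$ (all weights equal to $1$). A *system of variables* of $B$ is a triple $(x_1,x_2,x_3)$ of elements of $B$ with $B=k[x_1,x_2,x_3]$, i.e. such that $U\mapsto x_1,\ V\mapsto x_2,\ W\mapsto x_3$ defines a $k$-algebra automorphism of $B$. Let $D:B\to B$ be a $k$-derivation such that - $D$ is locally nilpotent: for every $b\in B$ there is $m\ge 0$ with $D^m(b)=0$; - $D$ is irreducible: if $b\in B$ and $D(B)\subseteq bB$, then $b$ is a unit of $B$; - $D$ is homogeneous of degree $p-2$: $D(B_i)\subseteq B_{i+p-2}$ for all $i$; - $D$ has rank $2$, where the rank of $D$ is the least integer $r\ge 0$ such that some system of variables $(x_1,x_2,x_3)$ of $B$ satisfies $D(x_i)=0$ for all $i>r$. Then $D$ is triangularizable: there is a system of variables $(x_1,x_2,x_3)$ of $B$ with $D(x_1)=0$, $D(x_2)\in k[x_1]$ and $D(x_3)\in k[x_1,x_2]$. -/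

import Mathlib

namespace PolyDer

open MvPolynomial

/-- A derivation `D` is locally nilpotent: every element is killed by some iterate of `D`. -/
def IsLocallyNilpotent {k B : Type*} [CommRing k] [CommRing B] [Algebra k B]
    (D : Derivation k B B) : Prop :=
  ∀ b : B, ∃ m : ℕ, (⇑D)^[m] b = 0

/-- A derivation `D` is irreducible: its image lies in no proper principal ideal, that is,
`D B ⊆ b B` only for units `b`. (In particular the zero derivation of a nonzero ring is not
irreducible, as seen from `b = 0`.) -/
def IsIrreducible {k B : Type*} [CommRing k] [CommRing B] [Algebra k B]
    (D : Derivation k B B) : Prop :=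
  ∀ b : B, (∀ f : B, b ∣ D f) → IsUnit b

/-- `D` is homogeneous of degree `d : ℤ` for the standard grading (all weights `1`) of
`B = k[X₀, …, Xₙ₋₁]`: `D Bᵢ ⊆ Bᵢ₊ᵈ` for all `i`, where the graded pieces of negative degree
are zero. -/
def IsHomogeneousOfDegree {k : Type*} [CommRing k] {n : ℕ}
    (D : Derivation k (MvPolynomial (Fin n) k) (MvPolynomial (Fin n) k)) (d : ℤ) : Prop :=
  ∀ (i : ℕ) (f : MvPolynomial (Fin n) k), f.IsHomogeneous i →
    D f = 0 ∨ ∃ j : ℕ, (j : ℤ) = (i : ℤ) + d ∧ (D f).IsHomogeneous j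

/-- `x` is a system of variables (coordinate system) of `k[X₀, …, Xₙ₋₁]`: the
`k`-algebra endomorphism `Xᵢ ↦ xᵢ` is an automorphism. -/
def IsSystemOfVariables {k : Type*} [CommRing k] {n : ℕ}
    (x : Fin n → MvPolynomial (Fin n) k) : Prop :=
  Function.Bijective (aeval x : MvPolynomial (Fin n) k →ₐ[k] MvPolynomial (Fin n) k)

/-- The rank of `D`: the least `r` for which there is a system of variables of which all but
(at most) the first `r` lie in the kernel of `D`. The set is nonempty, as `r = n` belongs to it. -/
noncomputable def rank {k : Type*} [CommRing k] {n : ℕ}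
    (D : Derivation k (MvPolynomial (Fin n) k) (MvPolynomial (Fin n) k)) : ℕ :=
  sInf {r : ℕ | ∃ x : Fin n → MvPolynomial (Fin n) k, IsSystemOfVariables x ∧
    ∀ i : Fin n, r ≤ (i : ℕ) → D (x i) = 0}

/-- A derivation of `k[U, V, W]` is triangularizable: for some system of variables
`{x₀, x₁, x₂}` one has `D x₀ = 0`, `D x₁ ∈ k[x₀]` and `D x₂ ∈ k[x₀, x₁]`. -/
def IsTriangularizable {k : Type*} [CommRing k]
    (D : Derivation k (MvPolynomial (Fin 3) k) (MvPolynomial (Fin 3) k)) : Prop :=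
  ∃ x : Fin 3 → MvPolynomial (Fin 3) k, IsSystemOfVariables x ∧
    D (x 0) = 0 ∧
    D (x 1) ∈ Algebra.adjoin k {x 0} ∧
    D (x 2) ∈ Algebra.adjoin k {x 0, x 1}

end PolyDer

/-! Put n = p - 1, so that D sends linear forms to forms of degree n. Rank 2 puts a member of a
system of variables in the kernel. Its linear part is nonzero and, D being homogeneous, is also
killed, so a linear change of variables gives D X₀ = 0. Setting X₀ = 0 induces a homogeneous locally
nilpotent derivation of k[u, v], which kills a linear form (`exists_linear_form`). After a second
linear change X₀ divides D X₁, and irreducibility prevents it from dividing D X₂.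

Setting X₀ = 1 loses no monomial, by homogeneity, and gives a locally nilpotent Δ on k[u, v] with
deg Δu < n and Δv = c uⁿ + (terms of degree < n), c ≠ 0. It suffices that Δu ∈ k and Δv ∈ k[u]
(`eq_zero_of_mem_support_of_isLocallyNilpotent`). Unless Δu = 0 and Δv ∈ k[u], a Newton polygon
argument produces coprime weights α < β whose leading derivation L is locally nilpotent, with Lu ≠ 0
and uⁿ occurring in Lv. Then `weights_of_isHomogeneousDerivation` forces β = (n + 1)α, and this
slope leaves room only for the desired monomials.

The main tool is the degree in T of exp(TD): it is additive on products, and D lowers it by one when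
it is positive. Primality of p is decisive only in `eq_mul_of_degree_relations`, to exclude a proper
factorization n + 1 = β(M' + 1). -/

namespace PolyDer

open MvPolynomial

/-! ### The exponential of a locally nilpotent derivation and its degree function. -/

section Exponential

variable {k B : Type*} [Field k] [CommRing B] [Algebra k B]

open Finset in
theorem iterate_mul (D : Derivation k B B) (n : ℕ) (a b : B) :
    D^[n] (a * b) = ∑ ij ∈ antidiagonal n, n.choose ij.1 • (D^[ij.1] a * D^[ij.2] b) := by
  induction n with
  | zero => simp
  | succ n ih =>
    rw [sum_antidiagonal_choose_succ_nsmul (M := B) (fun i j => D^[i] a * D^[j] b) n]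
    simp only [Function.iterate_succ_apply', ih, map_sum, map_nsmul, Derivation.leibniz, smul_add,
      sum_add_distrib, smul_eq_mul]
    congr 1
    exact sum_congr rfl fun x hx => by
      rw [mul_comm, Nat.choose_symm_of_eq_add (HasAntidiagonal.mem_antidiagonal.1 hx).symm]

theorem iterate_eq_zero_of_le (D : Derivation k B B) {m n : ℕ} {b : B} (h : D^[m] b = 0)
    (hmn : m ≤ n) : D^[n] b = 0 := by
  obtain ⟨i, rfl⟩ := Nat.exists_eq_add_of_le' hmn
  rw [Function.iterate_add_apply, h]
  exact Function.iterate_fixed (map_zero D) i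

theorem iterate_smul (D : Derivation k B B) (n : ℕ) (c : k) (a : B) :
    D^[n] (c • a) = c • D^[n] a := by
  induction n with
  | zero => rfl
  | succ n ih => rw [Function.iterate_succ_apply', Function.iterate_succ_apply', ih, Derivation.map_smul]

open Classical in
/-- The polynomial `∑ₙ Dⁿ(f) / n! Tⁿ`. -/
noncomputable def expFun {D : Derivation k B B} (hD : IsLocallyNilpotent D) (f : B) :
    Polynomial B :=
  ∑ n ∈ Finset.range (Nat.find (hD f)), Polynomial.monomial n ((n.factorial : k)⁻¹ • D^[n] f)

theorem coeff_expFun {D : Derivation k B B} (hD : IsLocallyNilpotent D) (f : B) (n : ℕ) :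
    (expFun hD f).coeff n = (n.factorial : k)⁻¹ • D^[n] f := by
  classical
  simp only [expFun, Polynomial.finsetSum_coeff, Polynomial.coeff_monomial,
    Finset.sum_ite_eq', Finset.mem_range]
  split_ifs with h
  · rfl
  · rw [iterate_eq_zero_of_le D (Nat.find_spec (hD f)) (by simpa using h), smul_zero]

variable [CharZero k]

/-- The exponential `exp(T D)` of a locally nilpotent derivation, as a homomorphism `B → B[T]`. -/
noncomputable def exp {D : Derivation k B B} (hD : IsLocallyNilpotent D) : B →ₐ[k] Polynomial B :=
  AlgHom.ofLinearMap
    { toFun := expFun hD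
      map_add' := fun a b => by
        ext n; simp [coeff_expFun]
      map_smul' := fun c a => by
        ext n; simp [coeff_expFun, iterate_smul, smul_comm c] }
    (by
      ext n
      rcases n with _ | n
      · simp [coeff_expFun]
      · simp [coeff_expFun, Polynomial.coeff_one, Function.iterate_succ_apply,
          Function.iterate_fixed (map_zero D) n])
    (fun a b => by
      ext n
      simp only [LinearMap.coe_mk, AddHom.coe_mk, coeff_expFun, Polynomial.coeff_mul, iterate_mul,
        Finset.smul_sum]
      refine Finset.sum_congr rfl fun ij hij => ?_
      obtain rfl := Finset.HasAntidiagonal.mem_antidiagonal.1 hij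
      rw [smul_mul_smul_comm, ← Nat.cast_smul_eq_nsmul k, smul_smul]
      congr 1
      have h1 := Nat.cast_ne_zero (R := k).2 (ij.1.factorial_ne_zero)
      have h2 := Nat.cast_ne_zero (R := k).2 (ij.2.factorial_ne_zero)
      have h3 := Nat.cast_ne_zero (R := k).2 ((ij.1 + ij.2).factorial_ne_zero)
      have h4 := congrArg (Nat.cast (R := k)) (Nat.add_choose_mul_factorial_mul_factorial ij.1 ij.2)
      push_cast at h4
      field_simp
      rw [← h4, Nat.choose_symm_add])

variable {D : Derivation k B B} (hD : IsLocallyNilpotent D)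

theorem coeff_exp (f : B) (n : ℕ) : (exp hD f).coeff n = (n.factorial : k)⁻¹ • D^[n] f :=
  coeff_expFun hD f n

theorem exp_injective : Function.Injective (exp hD) := fun a b h => by
  simpa [coeff_exp] using congrArg (fun q => Polynomial.coeff q 0) h

/-- Since `exp` turns D into d/dT, the behaviour of `deg` under D is that of polynomial degree under
differentiation in characteristic zero. -/
theorem derivative_exp (f : B) : Polynomial.derivative (exp hD f) = exp hD (D f) := by
  ext n
  rw [Polynomial.coeff_derivative, coeff_exp, coeff_exp, ← Function.iterate_succ_apply,
    Nat.factorial_succ]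
  have h1 := Nat.cast_ne_zero (R := k).2 (n.factorial_ne_zero)
  have h2 : (n + 1 : k) ≠ 0 := by exact_mod_cast n.succ_ne_zero
  have : ((n : B) + 1) = algebraMap k B (n + 1) := by simp
  rw [this, mul_comm, ← Algebra.smul_def, smul_smul]
  congr 1
  push_cast
  field_simp

/-- The degree of an element with respect to a locally nilpotent derivation. -/
noncomputable def deg (f : B) : ℕ := (exp hD f).natDegree

theorem deg_eq_zero_iff (f : B) : deg hD f = 0 ↔ D f = 0 := by
  constructor
  · intro h
    apply exp_injective hD
    rw [← derivative_exp, map_zero]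
    rw [deg, Polynomial.natDegree_eq_zero] at h
    obtain ⟨c, hc⟩ := h
    rw [← hc, Polynomial.derivative_C]
  · intro h
    rw [deg, ← Nat.le_zero, Polynomial.natDegree_le_iff_coeff_eq_zero]
    intro n hn
    rw [coeff_exp, iterate_eq_zero_of_le D (m := 1) h hn, smul_zero]

variable [IsDomain B]

theorem deg_mul {f g : B} (hf : f ≠ 0) (hg : g ≠ 0) : deg hD (f * g) = deg hD f + deg hD g := by
  rw [deg, map_mul, Polynomial.natDegree_mul]
  · rfl
  · exact (map_ne_zero_iff _ (exp_injective hD)).2 hf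
  · exact (map_ne_zero_iff _ (exp_injective hD)).2 hg

theorem deg_pow (f : B) (n : ℕ) : deg hD (f ^ n) = n * deg hD f := by
  rw [deg, map_pow, Polynomial.natDegree_pow, deg]

theorem deg_derivation (f : B) : deg hD (D f) = deg hD f - 1 := by
  have : CharZero B := charZero_of_injective_algebraMap (algebraMap k B).injective
  rw [deg, ← derivative_exp, Polynomial.natDegree_derivative, deg]

/-- A nonzero multiple of f has degree at least deg f, whereas D lowers a positive degree. -/
theorem derivation_eq_zero_of_dvd {D : Derivation k B B} (hD : IsLocallyNilpotent D)
    {f : B} (h : f ∣ D f) : D f = 0 := by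
  by_contra h0
  obtain ⟨q, hq⟩ := h
  have hf : f ≠ 0 := by rintro rfl; simp at h0
  have hq0 : q ≠ 0 := by rintro rfl; simp [hq] at h0
  have h1 := deg_derivation hD f
  rw [hq, deg_mul hD hf hq0] at h1
  exact h0 ((deg_eq_zero_iff hD f).1 (by omega))

theorem derivation_leadingCoeff_exp (f : B) : D (exp hD f).leadingCoeff = 0 := by
  rw [Polynomial.leadingCoeff, coeff_exp, Derivation.map_smul, ← Function.iterate_succ_apply' (⇑D)]
  have h : (exp hD f).coeff ((exp hD f).natDegree + 1) = 0 :=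
    Polynomial.coeff_eq_zero_of_natDegree_lt (Nat.lt_succ_self _)
  rw [coeff_exp, smul_eq_zero] at h
  rcases h with h | h
  · exact absurd h (inv_ne_zero (Nat.cast_ne_zero.2 (Nat.factorial_ne_zero _)))
  · rw [h, smul_zero]

end Exponential

/-! ### Nilpotency on generators, and polynomials with equal logarithmic derivatives. -/

section Generators

variable {k σ : Type*} [Field k]

theorem isLocallyNilpotent_of_X {D : Derivation k (MvPolynomial σ k) (MvPolynomial σ k)}
    (h : ∀ i, ∃ m, D^[m] (X i) = 0) : IsLocallyNilpotent D := by
  have hmul : ∀ f g : MvPolynomial σ k, (∃ m, D^[m] f = 0) → (∃ m, D^[m] g = 0) →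
      ∃ m, D^[m] (f * g) = 0 := by
    rintro f g ⟨m, hm⟩ ⟨n, hn⟩
    refine ⟨m + n, ?_⟩
    rw [iterate_mul]
    refine Finset.sum_eq_zero fun ij hij => ?_
    have h1 := Finset.HasAntidiagonal.mem_antidiagonal.1 hij
    rcases le_or_gt m ij.1 with h2 | h2
    · rw [iterate_eq_zero_of_le D hm h2, zero_mul, smul_zero]
    · rw [iterate_eq_zero_of_le D hn (by omega), mul_zero, smul_zero]
  intro f
  induction f using MvPolynomial.induction_on with
  | C a => exact ⟨1, by simp⟩
  | add f g hf hg =>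
    obtain ⟨m, hm⟩ := hf
    obtain ⟨n, hn⟩ := hg
    refine ⟨max m n, ?_⟩
    rw [iterate_map_add, iterate_eq_zero_of_le D hm (le_max_left _ _),
      iterate_eq_zero_of_le D hn (le_max_right _ _), add_zero]
  | mul_X f i hf => exact hmul _ _ hf (h i)

theorem isLocallyNilpotent_pderiv (i : σ) :
    IsLocallyNilpotent (pderiv i : Derivation k (MvPolynomial σ k) (MvPolynomial σ k)) := by
  classical
  refine isLocallyNilpotent_of_X fun j => ⟨2, ?_⟩
  rcases eq_or_ne j i with rfl | h
  · simp
  · simp [pderiv_X_of_ne h]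

theorem eq_C_of_pderiv_eq_zero [CharZero k] {f : MvPolynomial σ k} (h : ∀ i, pderiv i f = 0) :
    f = C (coeff 0 f) := by
  classical
  ext s
  rw [coeff_C]
  split_ifs with hs
  · rw [hs]
  · obtain ⟨i, hi⟩ : ∃ i, s i ≠ 0 := by
      by_contra! hc
      exact hs (Finsupp.ext fun i => (hc i).symm)
    have h1 := coeff_pderiv (i := i) f (s - Finsupp.single i 1)
    have h2 : s - Finsupp.single i 1 + Finsupp.single i 1 = s :=
      tsub_add_cancel_of_le (Finsupp.single_le_iff.2 (Nat.one_le_iff_ne_zero.2 hi))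
    rw [h i, h2, coeff_zero] at h1
    refine (mul_eq_zero.1 h1.symm).resolve_right ?_
    exact Nat.cast_add_one_ne_zero _

/-- Two polynomials with the same logarithmic derivatives are proportional. -/
theorem exists_eq_C_mul_of_pderiv [CharZero k] {r s : MvPolynomial σ k} (hs : s ≠ 0)
    (h : ∀ i, r * pderiv i s = s * pderiv i r) : ∃ c : k, r = C c * s := by
  -- Once the common factor c is removed, coprimality makes s' divide each of its partial
  -- derivatives. These derivations are locally nilpotent, so s' is constant, and then so is r'.
  obtain ⟨s', r', c, hrel, rfl, rfl⟩ :=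
    UniqueFactorizationMonoid.exists_reduced_factors s hs r
  have hc : c ≠ 0 := left_ne_zero_of_mul hs
  have hs' : s' ≠ 0 := right_ne_zero_of_mul hs
  have h' : ∀ i, r' * pderiv i s' = s' * pderiv i r' := fun i => by
    have h1 := h i
    rw [pderiv_mul, pderiv_mul] at h1
    refine mul_left_cancel₀ (mul_ne_zero hc hc) ?_
    linear_combination h1
  have h1 : ∀ i, pderiv i s' = 0 := fun i =>
    derivation_eq_zero_of_dvd (isLocallyNilpotent_pderiv i)
      (hrel.dvd_of_dvd_mul_left ⟨_, h' i⟩)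
  have h2 : ∀ i, pderiv i r' = 0 := fun i => by
    have h3 := h' i
    rw [h1 i, mul_zero] at h3
    exact (mul_eq_zero.1 h3.symm).resolve_left hs'
  have h3 := eq_C_of_pderiv_eq_zero h1
  have h4 := eq_C_of_pderiv_eq_zero h2
  have h5 : coeff 0 s' ≠ 0 := fun h0 => hs' (by rw [h3, h0, C_0])
  refine ⟨coeff 0 r' / coeff 0 s', ?_⟩
  rw [h3, h4, coeff_zero_C, coeff_zero_C, mul_left_comm, ← C_mul,
    div_mul_cancel₀ _ h5]

end Generators

/-! ### Weighted homogeneous polynomials in two variables. -/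

section TwoVariables

variable {k : Type*} [Field k]

theorem weight_fin_two (α β : ℤ) (s : Fin 2 →₀ ℕ) :
    Finsupp.weight ![α, β] s = s 0 * α + s 1 * β := by
  simp [Finsupp.weight_apply, Finsupp.sum_fintype]

theorem monomial_fin_two (s : Fin 2 →₀ ℕ) (c : k) :
    monomial s c = C c * (X 0 ^ s 0 * X 1 ^ s 1) := by
  rw [monomial_eq, Finsupp.prod_fintype _ _ (by simp), Fin.prod_univ_two]

theorem derivation_fin_two {D : Derivation k (MvPolynomial (Fin 2) k) (MvPolynomial (Fin 2) k)}
    (f : MvPolynomial (Fin 2) k) :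
    D f = pderiv 0 f * D (X 0) + pderiv 1 f * D (X 1) := by
  have : D = D (X 0) • pderiv 0 + D (X 1) • pderiv 1 := by
    apply derivation_ext
    intro i
    fin_cases i <;> simp
  conv_lhs => rw [this]
  simp [mul_comm]

theorem euler_fin_two {α β m : ℤ} {f : MvPolynomial (Fin 2) k}
    (hf : IsWeightedHomogeneous ![α, β] f m) :
    (α : MvPolynomial (Fin 2) k) * (X 0 * pderiv 0 f) + (β : MvPolynomial (Fin 2) k) *
      (X 1 * pderiv 1 f) = (m : MvPolynomial (Fin 2) k) * f := by
  rw [f.as_sum]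
  simp only [map_sum, Finset.mul_sum, ← Finset.sum_add_distrib]
  refine Finset.sum_congr rfl fun s hs => ?_
  rw [X_mul_pderiv_monomial, X_mul_pderiv_monomial, ← hf (mem_support_iff.1 hs), weight_fin_two]
  push_cast
  simp only [nsmul_eq_mul]
  ring

/-- Homogeneous elements of equal weight in the kernel of a nonzero derivation of `k[u, v]`
are proportional. -/
theorem exists_eq_C_mul_of_isWeightedHomogeneous [CharZero k]
    {D : Derivation k (MvPolynomial (Fin 2) k) (MvPolynomial (Fin 2) k)} (hD : D ≠ 0)
    {α β m : ℤ} (hα : 0 < α) (hβ : 0 < β) {r s : MvPolynomial (Fin 2) k} (hs0 : s ≠ 0)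
    (hr : IsWeightedHomogeneous ![α, β] r m) (hs : IsWeightedHomogeneous ![α, β] s m)
    (hDr : D r = 0) (hDs : D s = 0) : ∃ c : k, r = C c * s := by
  have : CharZero (MvPolynomial (Fin 2) k) :=
    charZero_of_injective_algebraMap (algebraMap k _).injective
  rcases eq_or_ne m 0 with rfl | hm
  -- Euler's identity says nothing useful in weight 0, but there positivity of the weights leaves
  -- only constants.
  · have hC : ∀ f : MvPolynomial (Fin 2) k, IsWeightedHomogeneous ![α, β] f 0 →
        f = C (coeff 0 f) := by
      intro f hf
      ext t
      rw [coeff_C]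
      split_ifs with ht
      · rw [ht]
      · by_contra hc
        have h1 := hf hc
        rw [weight_fin_two] at h1
        have h4 : 0 ≤ (t 0 : ℤ) * α := by positivity
        have h5 : 0 ≤ (t 1 : ℤ) * β := by positivity
        have h2 : (t 0 : ℤ) = 0 :=
          (mul_eq_zero.1 (by linarith : (t 0 : ℤ) * α = 0)).resolve_right hα.ne'
        have h3 : (t 1 : ℤ) = 0 :=
          (mul_eq_zero.1 (by linarith : (t 1 : ℤ) * β = 0)).resolve_right hβ.ne'
        refine ht (Finsupp.ext fun i => ?_)
        fin_cases i
        · simpa using (Int.natCast_eq_zero.1 h2).symm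
        · simpa using (Int.natCast_eq_zero.1 h3).symm
    have h5 : coeff 0 s ≠ 0 := fun h0 => hs0 (by rw [hC s hs, h0, C_0])
    refine ⟨coeff 0 r / coeff 0 s, ?_⟩
    conv_lhs => rw [hC r hr]
    conv_rhs => rw [hC s hs]
    rw [coeff_zero_C, ← C_mul, div_mul_cancel₀ _ h5]
  · rw [derivation_fin_two] at hDr hDs
    -- Both gradients annihilate the nonzero vector (Du, Dv), so the Jacobian determinant of r and s
    -- vanishes.
    have hJ : pderiv 0 r * pderiv 1 s = pderiv 1 r * pderiv 0 s := by
      by_contra hJ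
      rw [← sub_eq_zero] at hJ
      refine hD (derivation_ext fun i => ?_)
      fin_cases i
      · refine (mul_eq_zero.1 ?_).resolve_left hJ
        simp only [Fin.zero_eta]
        linear_combination (pderiv 1 s) * hDr - (pderiv 1 r) * hDs
      · refine (mul_eq_zero.1 ?_).resolve_left hJ
        simp only [Fin.mk_one]
        linear_combination (pderiv 0 r) * hDs - (pderiv 0 s) * hDr
    have hm' : (m : MvPolynomial (Fin 2) k) ≠ 0 := Int.cast_ne_zero.2 hm
    refine exists_eq_C_mul_of_pderiv hs0 fun i => mul_left_cancel₀ hm' ?_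
    have er := euler_fin_two hr
    have es := euler_fin_two hs
    fin_cases i
    · simp only [Fin.zero_eta]
      linear_combination -(pderiv 0 s) * er + (pderiv 0 r) * es - (β : MvPolynomial (Fin 2) k) * X 1 * hJ
    · simp only [Fin.mk_one]
      linear_combination -(pderiv 1 s) * er + (pderiv 1 r) * es + (α : MvPolynomial (Fin 2) k) * X 0 * hJ

theorem aeval_fin_two {S : Type*} [CommRing S] [Algebra k S] (P Q : S)
    (h : MvPolynomial (Fin 2) k) :
    aeval ![P, Q] h = ∑ s ∈ h.support, algebraMap k S (coeff s h) * (P ^ s 0 * Q ^ s 1) := by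
  rw [aeval_def, eval₂_eq']
  simp

/-- If the degrees of `P` and `Q` are not proportional to the weights, then there is no
cancellation of leading terms in `h(P, Q)` for homogeneous `h`. -/
theorem le_natDegree_aeval {R : Type*} [CommRing R] [IsDomain R] [Algebra k R]
    {P Q : Polynomial R} (hP : P ≠ 0) (hQ : Q ≠ 0) {α β m : ℤ} (hα : α ≠ 0)
    (hne : α * Q.natDegree ≠ β * P.natDegree) {h : MvPolynomial (Fin 2) k}
    (hh : IsWeightedHomogeneous ![α, β] h m) {s : Fin 2 →₀ ℕ} (hs : s ∈ h.support) :
    s 0 * P.natDegree + s 1 * Q.natDegree ≤ (aeval ![P, Q] h).natDegree := by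
  have hterm : ∀ t ∈ h.support, (algebraMap k (Polynomial R) (coeff t h) *
      (P ^ t 0 * Q ^ t 1)).natDegree = t 0 * P.natDegree + t 1 * Q.natDegree := by
    intro t ht
    rw [IsScalarTower.algebraMap_apply k R (Polynomial R), Polynomial.algebraMap_eq,
      Polynomial.natDegree_C_mul, Polynomial.natDegree_mul (pow_ne_zero _ hP) (pow_ne_zero _ hQ),
      Polynomial.natDegree_pow, Polynomial.natDegree_pow]
    exact (map_ne_zero _).2 (mem_support_iff.1 ht)
  rw [aeval_fin_two, Polynomial.natDegree_sum_eq_of_disjoint]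
  · rw [← hterm s hs]
    exact Finset.le_sup
      (f := fun t => (algebraMap k (Polynomial R) (coeff t h) * (P ^ t 0 * Q ^ t 1)).natDegree) hs
  · rintro t ⟨ht, -⟩ t' ⟨ht', -⟩ htt' heq
    simp only [Function.comp] at heq
    rw [hterm t ht, hterm t' ht'] at heq
    have h1 := hh (mem_support_iff.1 ht)
    have h2 := hh (mem_support_iff.1 ht')
    rw [weight_fin_two] at h1 h2
    have heq' : (t 0 : ℤ) * P.natDegree + t 1 * Q.natDegree =
      t' 0 * P.natDegree + t' 1 * Q.natDegree := by exact_mod_cast heq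
    -- Equal weight and equal degree form a linear system in t - t' whose determinant is nonzero by
    -- `hne`.
    have h3 : ((t 1 : ℤ) - t' 1) * (α * Q.natDegree - β * P.natDegree) = 0 := by
      linear_combination α * heq' - P.natDegree * (h1 - h2)
    have h4 : (t 1 : ℤ) = t' 1 :=
      sub_eq_zero.1 ((mul_eq_zero.1 h3).resolve_right (sub_ne_zero.2 hne))
    have h5 : (t 0 : ℤ) = t' 0 := by
      refine mul_right_cancel₀ hα ?_
      linear_combination h1 - h2 - β * h4
    refine htt' (Finsupp.ext fun i => ?_)
    fin_cases i
    · exact_mod_cast h5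
    · exact_mod_cast h4

end TwoVariables

/-! ### Homogeneous locally nilpotent derivations of k[u, v] and their weights. -/

section Homogeneous

variable {k : Type*} [Field k]

theorem natDegree_aeval_le {R : Type*} [CommRing R] [Algebra k R]
    {P Q : Polynomial R} {α β m e : ℕ} (hP : P.natDegree ≤ α * e) (hQ : Q.natDegree ≤ β * e)
    {h : MvPolynomial (Fin 2) k}
    (hh : IsWeightedHomogeneous ![(α : ℤ), (β : ℤ)] h m) :
    (aeval ![P, Q] h).natDegree ≤ m * e := by
  rw [aeval_fin_two]
  refine Polynomial.natDegree_sum_le_of_forall_le _ _ fun s hs => ?_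
  have h1 := hh (mem_support_iff.1 hs)
  rw [weight_fin_two] at h1
  have h2 : s 0 * α + s 1 * β = m := by exact_mod_cast h1
  rw [IsScalarTower.algebraMap_apply k R (Polynomial R), Polynomial.algebraMap_eq]
  refine (Polynomial.natDegree_C_mul_le _ _).trans (Polynomial.natDegree_mul_le.trans ?_)
  calc _ ≤ s 0 * P.natDegree + s 1 * Q.natDegree :=
        add_le_add Polynomial.natDegree_pow_le Polynomial.natDegree_pow_le
    _ ≤ s 0 * (α * e) + s 1 * (β * e) := by gcongr
    _ = m * e := by rw [← h2]; ring

/-- Modulo u ^ β - c v ^ α, the power u ^ (βn) becomes c ^ n v ^ (αn). For n = 0 the stated weight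
may be negative, which is harmless because q = 0. -/
theorem exists_pow_eq_mul_add (α β : ℕ) (c : k) (n : ℕ) :
    ∃ q : MvPolynomial (Fin 2) k, X 0 ^ (β * n) = (X 0 ^ β - C c * X 1 ^ α) * q +
      C (c ^ n) * X 1 ^ (α * n) ∧
      IsWeightedHomogeneous ![(α : ℤ), (β : ℤ)] q (α * β * n - α * β) := by
  induction n with
  | zero => exact ⟨0, by simp, isWeightedHomogeneous_zero _ _ _⟩
  | succ n ih =>
    obtain ⟨q, hq, hw⟩ := ih
    refine ⟨X 0 ^ β * q + C (c ^ n) * X 1 ^ (α * n), ?_, ?_⟩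
    · rw [mul_add β, pow_add, hq, mul_one, mul_add α, pow_add, pow_succ c, C_mul, mul_one]
      ring_nf
    · refine IsWeightedHomogeneous.add ?_ ?_
      · convert! ((isWeightedHomogeneous_X k ![(α : ℤ), (β : ℤ)] 0).pow β).mul hw using 1
        simp; ring
      · convert! ((isWeightedHomogeneous_X k ![(α : ℤ), (β : ℤ)] 1).pow (α * n)).C_mul (c ^ n) using 1
        simp; ring

/-- Division of a weighted homogeneous polynomial by `u ^ β - c v ^ α` leaves a monomial. -/
theorem exists_eq_mul_add_monomial {α β : ℕ} (hβ : 0 < β) (hco : Nat.Coprime α β)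
    (c : k) {h : MvPolynomial (Fin 2) k} {m : ℤ}
    (hh : IsWeightedHomogeneous ![(α : ℤ), (β : ℤ)] h m) :
    ∃ (q : MvPolynomial (Fin 2) k) (t : Fin 2 →₀ ℕ) (a : k),
      h = (X 0 ^ β - C c * X 1 ^ α) * q + monomial t a ∧
      IsWeightedHomogeneous ![(α : ℤ), (β : ℤ)] q (m - α * β) ∧
      (a ≠ 0 → Finsupp.weight ![(α : ℤ), (β : ℤ)] t = m) := by
  rcases h.support.eq_empty_or_nonempty with h0 | ⟨s, hs⟩
  · rw [support_eq_empty.1 h0]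
    exact ⟨0, 0, 0, by simp, isWeightedHomogeneous_zero _ _ _, fun h => absurd rfl h⟩
  have hwt : ∀ t ∈ h.support, (t 0 : ℤ) * α + t 1 * β = m := fun t ht => by
    rw [← hh (mem_support_iff.1 ht), weight_fin_two]
  -- By coprimality, exponents of u in monomials of equal weight agree modulo β; replacing u ^ β by
  -- c v ^ α thus collapses all of them to a single monomial.
  have hmod : ∀ t ∈ h.support, t 0 % β = s 0 % β ∧
      t 1 + α * (t 0 / β) = s 1 + α * (s 0 / β) := by
    intro t ht
    have h1 : t 0 * α + t 1 * β = s 0 * α + s 1 * β := by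
      exact_mod_cast (hwt t ht).trans (hwt s hs).symm
    have h2 : t 0 % β = s 0 % β := by
      refine Nat.ModEq.cancel_left_of_coprime (c := α) hco.symm ?_
      have h3 : (t 0 * α + t 1 * β) % β = (s 0 * α + s 1 * β) % β := by rw [h1]
      rw [Nat.add_mul_mod_self_right, Nat.add_mul_mod_self_right] at h3
      rw [mul_comm α, mul_comm α]
      exact h3
    refine ⟨h2, Nat.eq_of_mul_eq_mul_right hβ ?_⟩

    have h4 := Nat.div_add_mod (t 0) β
    have h5 := Nat.div_add_mod (s 0) β
    rw [h2] at h4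
    zify at h1 h4 h5 ⊢
    linear_combination h1 + α * h4 - α * h5
  choose q hq hqw using exists_pow_eq_mul_add (k := k) α β c
  refine ⟨∑ t ∈ h.support, C (coeff t h) * (X 0 ^ (t 0 % β) * X 1 ^ t 1 * q (t 0 / β)),
    Finsupp.single 0 (s 0 % β) + Finsupp.single 1 (s 1 + α * (s 0 / β)),
    ∑ t ∈ h.support, coeff t h * c ^ (t 0 / β), ?_, ?_, fun _ => ?_⟩
  · conv_lhs => rw [h.as_sum]
    rw [map_sum, Finset.mul_sum, ← Finset.sum_add_distrib]
    refine Finset.sum_congr rfl fun t ht => ?_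
    obtain ⟨h1, h2⟩ := hmod t ht
    rw [monomial_fin_two, monomial_fin_two]
    simp only [Finsupp.add_apply, Finsupp.single_eq_same, C_mul]
    rw [Finsupp.single_eq_of_ne (by simp), Finsupp.single_eq_of_ne (by simp), zero_add, add_zero,
      ← h1, ← h2]
    have h3 : (X 0 : MvPolynomial (Fin 2) k) ^ t 0 = X 0 ^ (β * (t 0 / β)) * X 0 ^ (t 0 % β) := by
      rw [← pow_add, Nat.div_add_mod]
    rw [h3, hq, pow_add (X 1)]
    ring
  · refine IsWeightedHomogeneous.sum _ _ _ fun t ht => IsWeightedHomogeneous.C_mul ?_ _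
    convert! (((isWeightedHomogeneous_X k ![(α : ℤ), (β : ℤ)] 0).pow (t 0 % β)).mul
      ((isWeightedHomogeneous_X k ![(α : ℤ), (β : ℤ)] 1).pow (t 1))).mul (hqw (t 0 / β)) using 1
    rw [← hwt t ht]
    conv_lhs => rw [← Nat.div_add_mod (t 0) β]
    push_cast
    simp; ring
  · rw [weight_fin_two, ← hwt s hs]
    conv_rhs => rw [← Nat.div_add_mod (s 0) β]
    simp; ring

/-- A derivation is homogeneous of degree `d` with respect to the weights `w`. -/
def IsHomogeneousDerivation {σ : Type*} (w : σ → ℤ)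
    (D : Derivation k (MvPolynomial σ k) (MvPolynomial σ k)) (d : ℤ) : Prop :=
  ∀ ⦃f : MvPolynomial σ k⦄ ⦃m : ℤ⦄, IsWeightedHomogeneous w f m →
    IsWeightedHomogeneous w (D f) (m + d)

theorem IsHomogeneousDerivation.iterate {σ : Type*} {w : σ → ℤ}
    {D : Derivation k (MvPolynomial σ k) (MvPolynomial σ k)} {d : ℤ}
    (h : IsHomogeneousDerivation w D d) {f : MvPolynomial σ k} {m : ℤ}
    (hf : IsWeightedHomogeneous w f m) (n : ℕ) :
    IsWeightedHomogeneous w (D^[n] f) (m + n * d) := by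
  induction n with
  | zero => simpa using hf
  | succ n ih =>
    rw [Function.iterate_succ_apply']
    convert! h ih using 1
    push_cast; ring

theorem smul_isWeightedHomogeneous {σ : Type*} {w : σ → ℤ} {f : MvPolynomial σ k} {m : ℤ}
    (hf : IsWeightedHomogeneous w f m) (c : k) : IsWeightedHomogeneous w (c • f) m := by
  rw [smul_eq_C_mul]; exact hf.C_mul c

variable [CharZero k] {D : Derivation k (MvPolynomial (Fin 2) k) (MvPolynomial (Fin 2) k)}
  (hD : IsLocallyNilpotent D)

theorem aeval_exp (h : MvPolynomial (Fin 2) k) :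
    aeval ![exp hD (X 0), exp hD (X 1)] h = exp hD h := by
  have : aeval ![exp hD (X 0), exp hD (X 1)] = exp hD := by
    apply algHom_ext
    intro i
    fin_cases i <;> simp
  rw [this]

theorem deg_monomial (t : Fin 2 →₀ ℕ) {c : k} (hc : c ≠ 0) :
    deg hD (monomial t c) = t 0 * deg hD (X 0) + t 1 * deg hD (X 1) := by
  rw [monomial_fin_two, deg_mul hD (C_ne_zero.2 hc)
    (mul_ne_zero (pow_ne_zero _ (X_ne_zero _)) (pow_ne_zero _ (X_ne_zero _))),
    deg_mul hD (pow_ne_zero _ (X_ne_zero _)) (pow_ne_zero _ (X_ne_zero _)), deg_pow, deg_pow,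
    (deg_eq_zero_iff hD (C c)).2 (derivation_C _ _), zero_add]

theorem le_deg_of_mem_support {α β m : ℤ} (hα : α ≠ 0)
    (hne : α * deg hD (X 1) ≠ β * deg hD (X 0)) {h : MvPolynomial (Fin 2) k}
    (hh : IsWeightedHomogeneous ![α, β] h m) {s : Fin 2 →₀ ℕ} (hs : s ∈ h.support) :
    s 0 * deg hD (X 0) + s 1 * deg hD (X 1) ≤ deg hD h := by
  have h0 : ∀ i : Fin 2, exp hD (X i) ≠ 0 := fun i =>
    (map_ne_zero_iff _ (exp_injective hD)).2 (X_ne_zero i)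
  have := le_natDegree_aeval (h0 0) (h0 1) hα hne hh hs
  rwa [aeval_exp] at this

/-- The leading coefficients of `exp hD f` and `exp hD g` are homogeneous kernel elements of the
same weight, hence proportional; a scalar c therefore cancels the top powers of T. -/
theorem exists_deg_sub_lt {α β d : ℤ} (hα : 0 < α) (hβ : 0 < β)
    (hhom : IsHomogeneousDerivation ![α, β] D d)
    {f g : MvPolynomial (Fin 2) k} {m : ℤ} (hf : IsWeightedHomogeneous ![α, β] f m)
    (hg : IsWeightedHomogeneous ![α, β] g m) (hfg : deg hD f = deg hD g) (hpos : 0 < deg hD g) :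
    ∃ c : k, deg hD (f - C c * g) < deg hD g := by
  have hD0 : D ≠ 0 := by
    rintro rfl
    exact hpos.ne' ((deg_eq_zero_iff hD g).2 rfl)
  have hEg : exp hD g ≠ 0 := by
    intro h0; simp [deg, h0] at hpos
  have hEf : exp hD f ≠ 0 := by
    intro h0; rw [← hfg] at hpos; simp [deg, h0] at hpos
  have hw : ∀ {f : MvPolynomial (Fin 2) k}, IsWeightedHomogeneous ![α, β] f m →
      IsWeightedHomogeneous ![α, β] (exp hD f).leadingCoeff (m + deg hD f * d) := fun hf => by
    rw [Polynomial.leadingCoeff, coeff_exp]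
    exact smul_isWeightedHomogeneous (hhom.iterate hf _) _
  obtain ⟨c, hc⟩ := exists_eq_C_mul_of_isWeightedHomogeneous hD0 hα hβ
    (Polynomial.leadingCoeff_ne_zero.2 hEg) (hfg ▸ hw hf) (hw hg)
    (derivation_leadingCoeff_exp hD f) (derivation_leadingCoeff_exp hD g)
  have hc0 : c ≠ 0 := by
    rintro rfl
    rw [C_0, zero_mul, Polynomial.leadingCoeff_eq_zero] at hc
    exact hEf hc
  refine ⟨c, ?_⟩
  have hCg : exp hD (C c * g) = Polynomial.C (C c) * exp hD g := by
    rw [map_mul]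
    congr 1
    exact (exp hD).commutes c
  have hlt := Polynomial.degree_sub_lt_left (p := exp hD f) (q := exp hD (C c * g)) ?_ hEf ?_
  · rw [← map_sub] at hlt
    rcases eq_or_ne (exp hD (f - C c * g)) 0 with h0 | h0
    · rw [deg, h0]; simpa using hpos
    · rw [← hfg]
      exact Polynomial.natDegree_lt_natDegree h0 hlt
  · rw [hCg, Polynomial.degree_C_mul (C_ne_zero.2 hc0), Polynomial.degree_eq_natDegree hEf,
      Polynomial.degree_eq_natDegree hEg]
    exact congrArg _ hfg
  · rw [hCg, Polynomial.leadingCoeff_mul, Polynomial.leadingCoeff_C, hc]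

/-- Induction on the weight, bounded by N: divide h by g = u ^ β - c v ^ α. A monomial of weight m
has degree exactly me, while deg g is smaller than its weight predicts, so a small degree of h
forces either the remainder or the quotient to vanish. -/
theorem exists_eq_C_mul_pow_mul_pow {α β e : ℕ} (hα : 0 < α) (hβ : 0 < β)
    (hco : Nat.Coprime α β) (he0 : deg hD (X 0) = α * e) (he1 : deg hD (X 1) = β * e) {c : k}
    (hlt : deg hD (X 0 ^ β - C c * X 1 ^ α) < α * β * e) (N : ℕ) :
    ∀ ⦃h : MvPolynomial (Fin 2) k⦄ ⦃m : ℤ⦄, m < N → h ≠ 0 →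
    IsWeightedHomogeneous ![(α : ℤ), (β : ℤ)] h m → deg hD h < β * e →
    ∃ (a : k) (r M : ℕ), h = C a * (X 0 ^ r * (X 0 ^ β - C c * X 1 ^ α) ^ M) := by
  have hnonneg : ∀ {h : MvPolynomial (Fin 2) k} {m : ℤ}, h ≠ 0 →
      IsWeightedHomogeneous ![(α : ℤ), (β : ℤ)] h m → 0 ≤ m := by
    intro h m h0 hh
    obtain ⟨s, hs⟩ := exists_coeff_ne_zero h0
    rw [← hh hs, weight_fin_two]
    positivity
  induction N with
  | zero => exact fun _ _ hm h0 hh _ => absurd (hnonneg h0 hh) (by push_cast at hm; omega)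
  | succ N ih =>
    intro h m hm h0 hh hdeg
    obtain ⟨q, t, a, hq, hqw, ht⟩ := exists_eq_mul_add_monomial hβ hco c hh
    rcases eq_or_ne a 0 with rfl | ha
    · rw [monomial_zero, add_zero] at hq
      have hq0 : q ≠ 0 := by rintro rfl; simp [hq] at h0
      have hg0 : (X 0 ^ β - C c * X 1 ^ α : MvPolynomial (Fin 2) k) ≠ 0 := by
        intro hg; rw [hg, zero_mul] at hq; exact h0 hq
      have hαβ : 0 < (α : ℤ) * β := by positivity
      obtain ⟨b, r, M, hb⟩ := ih (m := m - α * β) (by push_cast at hm; omega) hq0 hqw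
        (by rw [hq, deg_mul hD hg0 hq0] at hdeg; omega)
      exact ⟨b, r, M + 1, by rw [hq, hb, pow_succ]; ring⟩
    · have hwt := ht ha
      rw [weight_fin_two] at hwt
      have hdm : deg hD (monomial t a) = (t 0 * α + t 1 * β) * e := by
        rw [deg_monomial hD t ha, he0, he1]; ring
      rcases eq_or_ne q 0 with rfl | hq0
      · rw [mul_zero, zero_add] at hq
        have h1 : t 1 = 0 := by
          rw [hq, hdm] at hdeg
          have := lt_of_mul_lt_mul_right hdeg (Nat.zero_le e)
          by_contra h1
          nlinarith [Nat.one_le_iff_ne_zero.2 h1]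
        exact ⟨a, t 0, 0, by rw [hq, monomial_fin_two, h1, pow_zero, pow_zero]⟩
      -- Here the monomial remainder dominates g q, so deg h is e times the weight of h. That weight
      -- is at least αβ ≥ β, against deg h < βe.
      · exfalso
        have hm0 := hnonneg hq0 hqw
        obtain ⟨x, hx⟩ := Int.eq_ofNat_of_zero_le hm0
        rw [hx] at hqw
        have hdq : deg hD q ≤ x * e := by
          rw [deg, ← aeval_exp]
          exact natDegree_aeval_le he0.le he1.le hqw
        have hx' : t 0 * α + t 1 * β = x + α * β := by
          zify; rw [hwt]; linarith
        have hlt' : deg hD ((X 0 ^ β - C c * X 1 ^ α) * q) < deg hD (monomial t a) := by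
          rw [hdm, hx', add_mul, deg, map_mul]
          refine Polynomial.natDegree_mul_le.trans_lt ?_
          rw [add_comm (x * e)]
          exact add_lt_add_of_lt_of_le hlt hdq
        have hEq : deg hD h = deg hD (monomial t a) := by
          rw [hq, deg, map_add, Polynomial.natDegree_add_eq_right_of_natDegree_lt hlt']
          rfl
        rw [hEq, hdm, hx'] at hdeg
        have h6 := lt_of_mul_lt_mul_right hdeg (Nat.zero_le e)
        nlinarith

/-- The arithmetic behind Du ~ u ^ r₀ g ^ M and Dv ~ u ^ r g ^ M', up to scalars, with c = deg g:
`e1` and `e3` compare weights, `e2` and `e4` compare degrees. -/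
theorem eq_mul_of_degree_relations {n α β e r₀ r M M' c : ℕ} {d : ℤ} (hn : (n + 1).Prime)
    (hα : 0 < α) (hαβ : α < β) (he : 0 < e) (hd : (n : ℤ) * α = β + d)
    (e1 : (α : ℤ) + d = r₀ * α + M * (α * β)) (e3 : (β : ℤ) + d = r * α + M' * (α * β))
    (e2 : α * e - 1 = r₀ * (α * e) + M * c) (e4 : β * e - 1 = r * (α * e) + M' * c)
    (hc : 0 < M → 0 < M' → c = 0) : β = (n + 1) * α := by
  have hβ : 0 < β := hα.trans hαβ
  have hα' : (0 : ℤ) < α := by exact_mod_cast hα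
  have hαe : 0 < α * e := by positivity
  have hβe : 0 < β * e := by positivity
  have hr0 : r₀ = 0 := by
    by_contra hr
    have := Nat.le_mul_of_pos_left (α * e) (Nat.pos_of_ne_zero hr)
    omega
  subst hr0
  rw [zero_mul, zero_add] at e2
  rw [Nat.cast_zero, zero_mul, zero_add] at e1
  rcases Nat.eq_zero_or_pos M with rfl | hMpos
  · have h2 : α * e = 1 := by rw [zero_mul] at e2; omega
    have h3 : α = 1 := Nat.eq_one_of_mul_eq_one_right h2
    rw [h3] at hd e1 ⊢
    push_cast at hd e1
    zify
    linarith
  rcases Nat.eq_zero_or_pos M' with rfl | hMpos'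
  · have hr : r = n := by
      have : (n : ℤ) * α = r * α := by rw [hd, e3]; simp
      exact_mod_cast (mul_right_cancel₀ hα'.ne' this).symm
    subst hr
    rw [zero_mul, add_zero] at e4
    have h5 : e = 1 := by
      refine Nat.dvd_one.1 ?_
      have h6 : β * e = r * α * e + 1 := by rw [mul_assoc]; omega
      exact (Nat.dvd_add_right (dvd_mul_left e (r * α))).1 (h6 ▸ dvd_mul_left e β)
    subst h5
    exfalso
    have h7 : (β : ℤ) = r * α + 1 := by
      have : β = r * α + 1 := by simp only [mul_one] at e4 hβe; omega
      exact_mod_cast this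
    have h8 : (α : ℤ) - 1 = M * (α * β) := by rw [← e1]; linarith
    have h9 : α * β ≤ M * (α * β) := Nat.le_mul_of_pos_left _ hMpos
    have h10 : α ≤ α * β := Nat.le_mul_of_pos_right _ hβ
    zify at h9 h10
    linarith
  · rw [hc hMpos hMpos', mul_zero] at e2 e4
    have h2 : α * e = 1 := by omega
    have h3 : α = 1 := Nat.eq_one_of_mul_eq_one_right h2
    have h3' : e = 1 := Nat.eq_one_of_mul_eq_one_left h2
    subst h3 h3'
    -- The case in which primality is needed: β divides n + 1 and exceeds α = 1.
    have h4 : n + 1 = β * (M' + 1) := by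
      have h6 : β = r + 1 := by omega
      have h5 := hd.trans e3
      push_cast at h5
      zify at h6 ⊢
      linarith
    rcases (Nat.dvd_prime hn).1 ⟨_, h4⟩ with h5 | h5
    · omega
    · rw [h5, mul_one]

theorem weights_of_isHomogeneousDerivation
    {D : Derivation k (MvPolynomial (Fin 2) k) (MvPolynomial (Fin 2) k)}
    (hD : IsLocallyNilpotent D) {n α β : ℕ} (hn : (n + 1).Prime) (hα : 0 < α)
    (hαβ : α < β) (hco : Nat.Coprime α β) {d : ℤ}
    (hhom : IsHomogeneousDerivation ![(α : ℤ), (β : ℤ)] D d) (h0 : D (X 0) ≠ 0)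
    (h1 : coeff (Finsupp.single 0 n) (D (X 1)) ≠ 0) : β = (n + 1) * α := by
  have hβ : 0 < β := hα.trans hαβ
  have hα' : (0 : ℤ) < α := by exact_mod_cast hα
  have hβ' : (0 : ℤ) < β := by exact_mod_cast hβ
  have hw0 : IsWeightedHomogeneous ![(α : ℤ), (β : ℤ)] (D (X 0)) (α + d) :=
    hhom (isWeightedHomogeneous_X k ![(α : ℤ), (β : ℤ)] 0)
  have hw1 : IsWeightedHomogeneous ![(α : ℤ), (β : ℤ)] (D (X 1)) (β + d) :=
    hhom (isWeightedHomogeneous_X k ![(α : ℤ), (β : ℤ)] 1)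
  have hd : (n : ℤ) * α = β + d := by
    rw [← hw1 h1, weight_fin_two]; simp
  have hD1 : D (X 1) ≠ 0 := by
    intro h; rw [h, coeff_zero] at h1; exact h1 rfl
  have ha : deg hD (X 0) ≠ 0 := fun h => h0 ((deg_eq_zero_iff hD _).1 h)
  have hb : deg hD (X 1) ≠ 0 := fun h => hD1 ((deg_eq_zero_iff hD _).1 h)
  have hda := deg_derivation hD (X 0)
  have hdb := deg_derivation hD (X 1)
  by_cases hprop : (α : ℤ) * deg hD (X 1) = β * deg hD (X 0)
  -- Degrees proportional to the weights: cancellation is possible, but only through powers of g = u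
  -- ^ β - c v ^ α.
  · have hprop' : α * deg hD (X 1) = β * deg hD (X 0) := by exact_mod_cast hprop
    obtain ⟨e, he0⟩ : α ∣ deg hD (X 0) := hco.dvd_of_dvd_mul_left ⟨_, hprop'.symm⟩
    have he1 : deg hD (X 1) = β * e := by
      refine Nat.eq_of_mul_eq_mul_left hα ?_
      rw [hprop', he0]; ring
    have he : 0 < e := Nat.pos_of_ne_zero fun h => ha (by rw [he0, h, mul_zero])
    have hN0 : deg hD (X 0 ^ β) = α * β * e := by rw [deg_pow, he0]; ring
    have hN1 : deg hD (X 1 ^ α) = α * β * e := by rw [deg_pow, he1]; ring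
    obtain ⟨c, hc⟩ := exists_deg_sub_lt hD hα' hβ' hhom (m := α * β)
      (f := X 0 ^ β) (g := X 1 ^ α)
      (by convert! (isWeightedHomogeneous_X k ![(α : ℤ), (β : ℤ)] 0).pow β using 1
          simp [mul_comm])
      (by convert! (isWeightedHomogeneous_X k ![(α : ℤ), (β : ℤ)] 1).pow α using 1)
      (hN0.trans hN1.symm) (by rw [hN1]; positivity)
    rw [hN1] at hc
    have key := fun N => exists_eq_C_mul_pow_mul_pow hD hα hβ hco he0 he1 hc N
    have hlt : α * e < β * e := Nat.mul_lt_mul_of_pos_right hαβ he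
    obtain ⟨γ, r₀, M, hM⟩ := key ((α + d).toNat + 1) (by push_cast; omega) h0 hw0 (by omega)
    obtain ⟨γ', r, M', hM'⟩ := key ((β + d).toNat + 1) (by push_cast; omega) hD1 hw1 (by omega)
    set g : MvPolynomial (Fin 2) k := X 0 ^ β - C c * X 1 ^ α with hg
    have hg0 : g ≠ 0 := by
      intro hg0
      have := congrArg (aeval ![(1 : k), 0]) hg0
      simp [hg, hα.ne'] at this
    have hgw : IsWeightedHomogeneous ![(α : ℤ), (β : ℤ)] g (α * β) := by
      refine IsWeightedHomogeneous.sub ?_ (IsWeightedHomogeneous.C_mul ?_ c)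
      · convert! (isWeightedHomogeneous_X k ![(α : ℤ), (β : ℤ)] 0).pow β using 1
        simp [mul_comm]
      · convert! (isWeightedHomogeneous_X k ![(α : ℤ), (β : ℤ)] 1).pow α using 1
    have hform : ∀ {f : MvPolynomial (Fin 2) k} {a : k} {r M : ℕ} {m : ℤ}, f ≠ 0 →
        IsWeightedHomogeneous ![(α : ℤ), (β : ℤ)] f m → f = C a * (X 0 ^ r * g ^ M) →
        m = r * α + M * (α * β) ∧ deg hD f = r * (α * e) + M * deg hD g := by
      intro f a r M m hf hfw hfa
      have ha0 : a ≠ 0 := by rintro rfl; simp [hfa] at hf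
      constructor
      · refine IsWeightedHomogeneous.inj_right hf hfw ?_
        rw [hfa]
        convert! (((isWeightedHomogeneous_X k ![(α : ℤ), (β : ℤ)] 0).pow r).mul
          (hgw.pow M)).C_mul a using 1
      · rw [hfa, deg_mul hD (C_ne_zero.2 ha0)
          (mul_ne_zero (pow_ne_zero _ (X_ne_zero _)) (pow_ne_zero _ hg0)),
          deg_mul hD (pow_ne_zero _ (X_ne_zero _)) (pow_ne_zero _ hg0), deg_pow, deg_pow,
          (deg_eq_zero_iff hD (C a)).2 (derivation_C _ _), zero_add, he0]
    obtain ⟨e1, e2⟩ := hform h0 hw0 hM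
    obtain ⟨e3, e4⟩ := hform hD1 hw1 hM'
    rw [hda, he0] at e2
    rw [hdb, he1] at e4
    refine eq_mul_of_degree_relations hn hα hαβ he hd e1 e3 e2 e4 fun hMpos hMpos' => ?_
    -- If g divides both Du and Dv, it divides Dg, hence Dg = 0.
    refine (deg_eq_zero_iff hD g).2 (derivation_eq_zero_of_dvd hD ?_)
    rw [derivation_fin_two, hM, hM']
    exact dvd_add (Dvd.dvd.mul_left (Dvd.dvd.mul_left (Dvd.dvd.mul_left
      (dvd_pow_self g hMpos.ne') _) _) _) (Dvd.dvd.mul_left (Dvd.dvd.mul_left (Dvd.dvd.mul_left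
      (dvd_pow_self g hMpos'.ne') _) _) _)
  -- Without proportionality nothing cancels, so no monomial of Du has degree above deg u - 1. The
  -- term uⁿ of Dv gives deg u < deg v; hence Du is constant and α + d = 0.
  · obtain ⟨s, hs⟩ := exists_coeff_ne_zero h0
    have h2 := le_deg_of_mem_support hD hα'.ne' hprop hw0 (mem_support_iff.2 hs)
    have h3 := le_deg_of_mem_support hD hα'.ne' hprop hw1 (mem_support_iff.2 h1)
    simp only [Finsupp.single_eq_same] at h3
    have hn0 : 0 < n := by have := hn.two_le; omega
    have h4 := Nat.le_mul_of_pos_left (deg hD (X 0)) hn0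
    have h5 : s 0 = 0 := by
      by_contra h
      have := Nat.le_mul_of_pos_left (deg hD (X 0)) (Nat.pos_of_ne_zero h)
      omega
    have h6 : s 1 = 0 := by
      by_contra h
      have := Nat.le_mul_of_pos_left (deg hD (X 1)) (Nat.pos_of_ne_zero h)
      omega
    have h7 := hw0 hs
    rw [weight_fin_two, h5, h6] at h7
    push_cast at h7
    zify
    linarith

end Homogeneous

/-! ### Linear forms in the kernel in two variables. -/

section LinearForm

variable {k : Type*} [Field k]

theorem isWeightedHomogeneous_one_iff {f : MvPolynomial (Fin 2) k} {n : ℕ} :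
    IsWeightedHomogeneous ![(1 : ℤ), 1] f n ↔ f.IsHomogeneous n := by
  refine forall_congr' fun s => imp_congr_right fun _ => ?_
  rw [weight_fin_two, Finsupp.weight_apply, Finsupp.sum_fintype _ _ (by simp)]
  simp only [Fin.sum_univ_two, Pi.one_apply, smul_eq_mul, mul_one]
  norm_cast

theorem isHomogeneousDerivation_of_X
    {D : Derivation k (MvPolynomial (Fin 2) k) (MvPolynomial (Fin 2) k)} {w : Fin 2 → ℤ} {d : ℤ}
    (h : ∀ i, IsWeightedHomogeneous w (D (X i)) (w i + d)) : IsHomogeneousDerivation w D d := by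
  intro f m hf
  rw [derivation_fin_two]
  have key : ∀ i, IsWeightedHomogeneous w (pderiv i f * D (X i)) (m + d) := fun i => by
    convert! (hf.pderiv (i := i) (n' := m - w i) (by ring)).mul (h i) using 1
    ring
  exact (key 0).add (key 1)

variable [CharZero k] {D : Derivation k (MvPolynomial (Fin 2) k) (MvPolynomial (Fin 2) k)}

/-- The y i are linear coordinates with inverse substitution z. As their degrees differ, the form D
(y 0) in y 0, y 1 has no cancellation; if nonzero, it would contain a monomial of positive degree,
contributing at least deg (y 0) > deg (D (y 0)). -/
theorem derivation_eq_zero_of_deg_lt (hD : IsLocallyNilpotent D) {n : ℕ} (hn : 0 < n)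
    {y z : Fin 2 → MvPolynomial (Fin 2) k} (hz : ∀ i, (z i).IsHomogeneous 1)
    (hyz : ∀ i, aeval y (z i) = X i) (hlt : deg hD (y 0) < deg hD (y 1))
    (hy : (D (y 0)).IsHomogeneous n) (hy0 : y 0 ≠ 0) : D (y 0) = 0 := by
  by_contra h0
  have hy1 : y 1 ≠ 0 := by
    rintro h
    rw [h, (deg_eq_zero_iff hD 0).2 (map_zero D)] at hlt
    exact absurd hlt (Nat.not_lt_zero _)
  have hyz' : aeval y (aeval z (D (y 0))) = D (y 0) := by
    have : (aeval y).comp (aeval z) = AlgHom.id k (MvPolynomial (Fin 2) k) :=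
      algHom_ext fun i => by rw [AlgHom.comp_apply, aeval_X, hyz, AlgHom.id_apply]
    exact DFunLike.congr_fun this _
  have hE : aeval ![exp hD (y 0), exp hD (y 1)] (aeval z (D (y 0))) = exp hD (D (y 0)) := by
    have : aeval ![exp hD (y 0), exp hD (y 1)] = (exp hD).comp (aeval y) := by
      apply algHom_ext
      intro i
      fin_cases i <;> simp
    rw [this, AlgHom.comp_apply, hyz']
  have hhom := isWeightedHomogeneous_one_iff.2 (hy.aeval z hz)
  obtain ⟨s, hs⟩ := exists_coeff_ne_zero (p := aeval z (D (y 0))) fun h => h0 (by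
    rw [← hyz', h, map_zero])
  have h1 := le_natDegree_aeval ((map_ne_zero_iff _ (exp_injective hD)).2 hy0)
    ((map_ne_zero_iff _ (exp_injective hD)).2 hy1) one_ne_zero
    (by simpa [deg] using hlt.ne') hhom (mem_support_iff.2 hs)
  rw [hE] at h1
  change s 0 * deg hD (y 0) + s 1 * deg hD (y 1) ≤ deg hD (D (y 0)) at h1
  rw [deg_derivation] at h1
  have ha : deg hD (y 0) ≠ 0 := fun h => h0 ((deg_eq_zero_iff hD _).1 h)
  have h5 : s 0 = 0 := by
    by_contra h
    have := Nat.le_mul_of_pos_left (deg hD (y 0)) (Nat.pos_of_ne_zero h)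
    omega
  have h6 : s 1 = 0 := by
    by_contra h
    have := Nat.le_mul_of_pos_left (deg hD (y 1)) (Nat.pos_of_ne_zero h)
    omega
  have h7 := hhom hs
  rw [weight_fin_two, h5, h6] at h7
  simp at h7
  omega

/-- A homogeneous locally nilpotent derivation of `k[u, v]` with `D u`, `D v` of positive degree
kills a nonzero linear form. -/
theorem exists_linear_form (hD : IsLocallyNilpotent D) {n : ℕ} (hn : 0 < n)
    (hhom : ∀ i, (D (X i)).IsHomogeneous n) :
    ∃ a b : k, (a ≠ 0 ∨ b ≠ 0) ∧ D (C a * X 0 + C b * X 1) = 0 := by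
  rcases lt_trichotomy (deg hD (X 0)) (deg hD (X 1)) with h | h | h
  · refine ⟨1, 0, Or.inl one_ne_zero, ?_⟩
    have := derivation_eq_zero_of_deg_lt hD hn (y := ![X 0, X 1]) (z := ![X 0, X 1])
      (by intro i; fin_cases i <;> simp [isHomogeneous_X])
      (by intro i; fin_cases i <;> simp) (by simpa using h) (by simpa using hhom 0)
      (by simp [X_ne_zero])
    simpa using this
  · rcases Nat.eq_zero_or_pos (deg hD (X 1)) with h1 | h1
    · refine ⟨0, 1, Or.inr one_ne_zero, ?_⟩
      simpa using (deg_eq_zero_iff hD _).1 h1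
    · have hw : IsHomogeneousDerivation ![(1 : ℤ), 1] D (n - 1) :=
        isHomogeneousDerivation_of_X fun i => by
          have := isWeightedHomogeneous_one_iff.2 (hhom i)
          fin_cases i <;> simpa using this
      -- Equal positive degrees are made unequal by replacing u with u - c v.
      obtain ⟨c, hc⟩ := exists_deg_sub_lt hD one_pos one_pos hw (f := X 0) (g := X 1) (m := 1)
        (isWeightedHomogeneous_X k ![(1 : ℤ), 1] 0) (isWeightedHomogeneous_X k ![(1 : ℤ), 1] 1) h h1
      refine ⟨1, -c, Or.inl one_ne_zero, ?_⟩
      have hne : (X 0 - C c * X 1 : MvPolynomial (Fin 2) k) ≠ 0 := by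
        intro h0
        have := congrArg (aeval ![(1 : k), 0]) h0
        simp at this
      have := derivation_eq_zero_of_deg_lt hD hn (y := ![X 0 - C c * X 1, X 1])
        (z := ![X 0 + C c * X 1, X 1])
        (by
          intro i
          fin_cases i
          · exact (isHomogeneous_X k 0).add ((isHomogeneous_X k 1).C_mul c)
          · exact isHomogeneous_X k 1)
        (by intro i; fin_cases i <;> simp [← algebraMap_eq]) (by simpa using hc)
        (by
          have h2 : D (X 0 - C c * X 1) = D (X 0) - C c * D (X 1) := by simp
          simp only [Matrix.cons_val_zero]
          rw [h2]
          exact (hhom 0).sub ((hhom 1).C_mul c))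
        (by simpa using hne)
      rw [← this]
      simp [sub_eq_add_neg]
  · refine ⟨0, 1, Or.inr one_ne_zero, ?_⟩
    have := derivation_eq_zero_of_deg_lt hD hn (y := ![X 1, X 0]) (z := ![X 1, X 0])
      (by intro i; fin_cases i <;> simp [isHomogeneous_X])
      (by intro i; fin_cases i <;> simp) (by simpa using h) (by simpa using hhom 1)
      (by simp [X_ne_zero])
    simpa using this

/-- When Du = 0, u has degree 0, so a monomial of Dv divisible by v would have degree at least deg
v, more than deg Dv. -/
theorem apply_one_eq_zero_of_coeff_ne_zero (hD : IsLocallyNilpotent D) {α β d : ℤ} (hα : α ≠ 0)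
    (hhom : IsWeightedHomogeneous ![α, β] (D (X 1)) d) (h0 : D (X 0) = 0)
    {s : Fin 2 →₀ ℕ} (hs : coeff s (D (X 1)) ≠ 0) : s 1 = 0 := by
  have h1 : D (X 1) ≠ 0 := by intro h; rw [h, coeff_zero] at hs; exact hs rfl
  have hb : deg hD (X 1) ≠ 0 := fun h => h1 ((deg_eq_zero_iff hD _).1 h)
  have ha : deg hD (X 0) = 0 := (deg_eq_zero_iff hD _).2 h0
  have h2 := le_deg_of_mem_support hD hα (by rw [ha]; simpa using ⟨hα, hb⟩) hhom
    (mem_support_iff.2 hs)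
  rw [deg_derivation, ha] at h2
  by_contra h
  have := Nat.le_mul_of_pos_left (deg hD (X 1)) (Nat.pos_of_ne_zero h)
  omega

end LinearForm

/-! ### Leading parts of derivations and the Newton polygon. -/

section Leading

variable {k : Type*} [Field k]

/-- All monomials of `f` have weight at most `m`. -/
def WeightLE {σ : Type*} (w : σ → ℤ) (f : MvPolynomial σ k) (m : ℤ) : Prop :=
  ∀ ⦃s⦄, coeff s f ≠ 0 → Finsupp.weight w s ≤ m

namespace WeightLE

variable {σ : Type*} {w : σ → ℤ} {f g : MvPolynomial σ k} {m n : ℤ}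

theorem add (hf : WeightLE w f m) (hg : WeightLE w g m) : WeightLE w (f + g) m := by
  intro s hs
  rw [coeff_add] at hs
  by_cases h : coeff s f = 0
  · rw [h, zero_add] at hs; exact hg hs
  · exact hf h

theorem mul (hf : WeightLE w f m) (hg : WeightLE w g n) : WeightLE w (f * g) (m + n) := by
  classical
  intro s hs
  rw [coeff_mul] at hs
  obtain ⟨⟨t, u⟩, htu, h⟩ := Finset.exists_ne_zero_of_sum_ne_zero hs
  rw [← Finset.HasAntidiagonal.mem_antidiagonal.1 htu, map_add]
  exact add_le_add (hf (left_ne_zero_of_mul h)) (hg (right_ne_zero_of_mul h))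

theorem pderiv (hf : WeightLE w f m) (i : σ) :
    WeightLE w (MvPolynomial.pderiv i f) (m - w i) := by
  intro s hs
  rw [coeff_pderiv] at hs
  have := hf (left_ne_zero_of_mul hs)
  rw [map_add, Finsupp.weight_single, one_smul] at this
  linarith

theorem derivation {D : Derivation k (MvPolynomial (Fin 2) k) (MvPolynomial (Fin 2) k)}
    {w : Fin 2 → ℤ} {f : MvPolynomial (Fin 2) k} {d : ℤ}
    (h : ∀ i, WeightLE w (D (X i)) (w i + d)) (hf : WeightLE w f m) :
    WeightLE w (D f) (m + d) := by
  rw [derivation_fin_two]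
  have key : ∀ i, WeightLE w (MvPolynomial.pderiv i f * D (X i)) (m + d) := fun i => by
    convert! (hf.pderiv i).mul (h i) using 1
    ring
  exact (key 0).add (key 1)

end WeightLE

/-- The leading part of a derivation of `k[u, v]`, in degree `d`. -/
noncomputable def leadingDerivation (w : Fin 2 → ℤ) (d : ℤ)
    (D : Derivation k (MvPolynomial (Fin 2) k) (MvPolynomial (Fin 2) k)) :
    Derivation k (MvPolynomial (Fin 2) k) (MvPolynomial (Fin 2) k) :=
  mkDerivation k fun i => weightedHomogeneousComponent w (w i + d) (D (X i))

theorem coeff_leadingDerivation_X (w : Fin 2 → ℤ) (d : ℤ)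
    (D : Derivation k (MvPolynomial (Fin 2) k) (MvPolynomial (Fin 2) k)) (i : Fin 2)
    (s : Fin 2 →₀ ℕ) : coeff s (leadingDerivation w d D (X i)) =
      if Finsupp.weight w s = w i + d then coeff s (D (X i)) else 0 := by
  rw [leadingDerivation, mkDerivation_X, coeff_weightedHomogeneousComponent]

theorem isHomogeneousDerivation_leadingDerivation (w : Fin 2 → ℤ) (d : ℤ)
    (D : Derivation k (MvPolynomial (Fin 2) k) (MvPolynomial (Fin 2) k)) :
    IsHomogeneousDerivation w (leadingDerivation w d D) d :=
  isHomogeneousDerivation_of_X fun i => by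
    rw [leadingDerivation, mkDerivation_X]
    exact weightedHomogeneousComponent_isWeightedHomogeneous _ _

theorem isLocallyNilpotent_leadingDerivation {w : Fin 2 → ℤ} {d : ℤ}
    {D : Derivation k (MvPolynomial (Fin 2) k) (MvPolynomial (Fin 2) k)}
    (hD : IsLocallyNilpotent D) (h : ∀ i, WeightLE w (D (X i)) (w i + d)) :
    IsLocallyNilpotent (leadingDerivation w d D) := by
  set L := leadingDerivation w d D with hL
  have hhom := isHomogeneousDerivation_leadingDerivation w d D
  have hsub : ∀ i, WeightLE w ((D - L) (X i)) (w i + (d - 1)) := by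
    intro i s hs
    rw [Derivation.sub_apply, coeff_sub, hL, coeff_leadingDerivation_X] at hs
    split_ifs at hs with h1
    · simp at hs
    · rw [sub_zero] at hs
      have := lt_of_le_of_ne (h i hs) h1
      omega
  -- L^N (X i) is the component of D^N (X i) of the highest weight allowed, so it vanishes as soon
  -- as D^N (X i) does.
  have key : ∀ i N, WeightLE w (D^[N] (X i) - L^[N] (X i)) (w i + N * d - 1) := by
    intro i N
    induction N with
    | zero => intro s hs; simp at hs
    | succ N ih =>
      have h1 : WeightLE w (L^[N] (X i)) (w i + N * d) := fun s hs =>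
        (hhom.iterate (isWeightedHomogeneous_X k w i) N hs).le
      have h2 := (ih.derivation h).add
        (by convert! h1.derivation hsub using 1; ring : WeightLE w ((D - L) (L^[N] (X i))) _)
      rw [Function.iterate_succ_apply', Function.iterate_succ_apply']
      convert! h2 using 1
      · simp
      · push_cast; ring
  refine isLocallyNilpotent_of_X fun i => ?_
  obtain ⟨N, hN⟩ := hD (X i)
  refine ⟨N, ?_⟩
  by_contra h0
  obtain ⟨s, hs⟩ := exists_coeff_ne_zero h0
  have h1 := key i N (s := s) (by rw [hN, zero_sub, coeff_neg]; exact neg_ne_zero.2 hs)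
  have h2 := hhom.iterate (isWeightedHomogeneous_X k w i) N hs
  omega

/-- The ratio β/α is the minimum of z.1/z.2 over S, in lowest terms: the slope of a Newton polygon
edge. -/
theorem exists_coprime_slope {S : Finset (ℕ × ℕ)} (hS : S.Nonempty)
    (h : ∀ z ∈ S, 0 < z.2 ∧ z.2 < z.1) : ∃ α β : ℕ, 0 < α ∧ α < β ∧ Nat.Coprime α β ∧
      (∀ z ∈ S, z.2 * β ≤ z.1 * α) ∧ ∃ z ∈ S, z.2 * β = z.1 * α := by
  obtain ⟨z, hz, hmin⟩ := S.exists_min_image (fun z => (z.1 : ℚ) / z.2) hS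
  obtain ⟨h1, h2⟩ := h z hz
  have hg : 0 < Nat.gcd z.2 z.1 := Nat.gcd_pos_of_pos_left _ h1
  obtain ⟨α, β, hco, hα, hβ⟩ := Nat.exists_coprime z.2 z.1
  set g := Nat.gcd z.2 z.1
  refine ⟨α, β, ?_, ?_, hco, fun y hy => ?_, z, hz, ?_⟩
  · exact Nat.pos_of_ne_zero fun h0 => by rw [h0, zero_mul] at hα; omega
  · rw [hα, hβ] at h2
    exact lt_of_mul_lt_mul_right h2 (Nat.zero_le g)
  · have h3 := hmin y hy
    rw [div_le_div_iff₀ (by exact_mod_cast h1) (by exact_mod_cast (h y hy).1)] at h3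
    have h4 : z.1 * y.2 ≤ y.1 * z.2 := by exact_mod_cast h3
    rw [hα, hβ] at h4
    refine le_of_mul_le_mul_right ?_ hg
    linarith
  · conv_lhs => rw [hα]
    conv_rhs => rw [hβ]
    ring

variable [CharZero k]

theorem eq_zero_of_mem_support_of_isLocallyNilpotent
    {D : Derivation k (MvPolynomial (Fin 2) k) (MvPolynomial (Fin 2) k)}
    (hD : IsLocallyNilpotent D) {n : ℕ} (hn : (n + 1).Prime)
    (h0 : ∀ s, coeff s (D (X 0)) ≠ 0 → s 0 + s 1 < n)
    (h1 : ∀ s, coeff s (D (X 1)) ≠ 0 → s 0 + s 1 < n ∨ (s 1 = 0 ∧ s 0 = n))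
    (hc : coeff (Finsupp.single 0 n) (D (X 1)) ≠ 0) :
    (∀ s, coeff s (D (X 0)) ≠ 0 → s 0 = 0 ∧ s 1 = 0) ∧
      ∀ s, coeff s (D (X 1)) ≠ 0 → s 1 = 0 := by
  classical
  -- A pair z encodes a monomial so that z.2 β ≤ z.1 α says that its weight is at most the weight of
  -- its variable plus d = nα - β, the degree for which uⁿ is leading in D v.
  set S : Finset (ℕ × ℕ) := (D (X 0)).support.image (fun s => (n + 1 - s 0, s 1 + 1)) ∪
    {s ∈ (D (X 1)).support | 0 < s 1}.image (fun s => (n - s 0, s 1)) with hS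
  have mem0 : ∀ s, coeff s (D (X 0)) ≠ 0 → (n + 1 - s 0, s 1 + 1) ∈ S := fun s hs =>
    Finset.mem_union_left _ (Finset.mem_image_of_mem _ (mem_support_iff.2 hs))
  have mem1 : ∀ s, coeff s (D (X 1)) ≠ 0 → 0 < s 1 → (n - s 0, s 1) ∈ S := fun s hs h =>
    Finset.mem_union_right _ (Finset.mem_image_of_mem (fun s : Fin 2 →₀ ℕ => (n - s 0, s 1))
      (Finset.mem_filter.2 ⟨mem_support_iff.2 hs, h⟩))
  have elim : ∀ z ∈ S, (∃ s, coeff s (D (X 0)) ≠ 0 ∧ z = (n + 1 - s 0, s 1 + 1)) ∨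
      ∃ s, coeff s (D (X 1)) ≠ 0 ∧ 0 < s 1 ∧ z = (n - s 0, s 1) := by
    intro z hz
    rcases Finset.mem_union.1 hz with hz | hz
    · obtain ⟨s, hs, rfl⟩ := Finset.mem_image.1 hz
      exact Or.inl ⟨s, mem_support_iff.1 hs, rfl⟩
    · obtain ⟨s, hs, rfl⟩ := Finset.mem_image.1 hz
      obtain ⟨hs, hs'⟩ := Finset.mem_filter.1 hs
      exact Or.inr ⟨s, mem_support_iff.1 hs, hs', rfl⟩
  rcases S.eq_empty_or_nonempty with hSe | hSne
  · refine ⟨fun s hs => ?_, fun s hs => ?_⟩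
    · exact absurd (hSe ▸ mem0 s hs) (Finset.notMem_empty _)
    · by_contra h
      exact absurd (hSe ▸ mem1 s hs (Nat.pos_of_ne_zero h)) (Finset.notMem_empty _)
  obtain ⟨α, β, hα, hαβ, hco, hle, z, hz, hzeq⟩ := exists_coprime_slope hSne (by
    intro z hz
    rcases elim z hz with ⟨s, hs, rfl⟩ | ⟨s, hs, hs1, rfl⟩
    · have := h0 s hs
      exact ⟨Nat.succ_pos _, by simp only; omega⟩
    · have := h1 s hs
      exact ⟨hs1, by simp only; omega⟩)
  have wt0 : ∀ s, coeff s (D (X 0)) ≠ 0 →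
      (((n + 1 - s 0 : ℕ) : ℤ) = n + 1 - s 0) := fun s hs => by have := h0 s hs; omega
  have wt1 : ∀ s, coeff s (D (X 1)) ≠ 0 →
      (((n - s 0 : ℕ) : ℤ) = n - s 0) := fun s hs => by have := h1 s hs; omega
  set w : Fin 2 → ℤ := ![(α : ℤ), (β : ℤ)] with hw
  set d : ℤ := n * α - β with hd
  have hLE : ∀ i, WeightLE w (D (X i)) (w i + d) := by
    intro i s hs
    rw [hw, weight_fin_two]
    fin_cases i
    · have h2 := hle _ (mem0 s hs)
      zify at h2
      rw [wt0 s hs] at h2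
      simp only [hd, Fin.zero_eta, Matrix.cons_val_zero]
      linarith
    · simp only [hd, Fin.mk_one, Matrix.cons_val_one, Matrix.cons_val_fin_one]
      rcases Nat.eq_zero_or_pos (s 1) with h3 | h3
      · have h4 : s 0 ≤ n := by have := h1 s hs; omega
        have h5 : s 0 * α ≤ n * α := Nat.mul_le_mul_right _ h4
        zify at h5
        rw [h3]
        push_cast
        linarith
      · have h2 := hle _ (mem1 s hs h3)
        zify at h2
        rw [wt1 s hs] at h2
        linarith
  have hLnil := isLocallyNilpotent_leadingDerivation hD hLE
  have hLhom := isHomogeneousDerivation_leadingDerivation w d D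
  have hL1 : coeff (Finsupp.single 0 n) (leadingDerivation w d D (X 1)) ≠ 0 := by
    rw [coeff_leadingDerivation_X, if_pos]
    · exact hc
    · rw [hw, weight_fin_two]
      simp [hd]
  -- The extremal point z is a monomial of Lu, or a monomial of Lv involving v; the latter is
  -- impossible if Lu = 0.
  have hL0 : leadingDerivation w d D (X 0) ≠ 0 := by
    intro hL0
    rcases elim z hz with ⟨s, hs, rfl⟩ | ⟨s, hs, hs1, rfl⟩
    · refine hs ?_
      zify at hzeq
      rw [wt0 s hs] at hzeq
      have h3 := coeff_leadingDerivation_X w d D 0 s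
      rw [hL0, if_pos] at h3
      · rw [← h3, coeff_zero]
      · rw [hw, weight_fin_two]
        simp only [hd, Matrix.cons_val_zero]
        linarith
    · zify at hzeq
      rw [wt1 s hs] at hzeq
      have h3 := coeff_leadingDerivation_X w d D 1 s
      rw [if_pos] at h3
      · rw [← h3] at hs
        exact hs1.ne' (apply_one_eq_zero_of_coeff_ne_zero hLnil
          (by exact_mod_cast hα.ne' : (α : ℤ) ≠ 0) (hLhom (isWeightedHomogeneous_X k w 1)) hL0 hs)
      · rw [hw, weight_fin_two]
        simp only [hd, Matrix.cons_val_one, Matrix.cons_val_fin_one]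
        linarith
  have hβ := weights_of_isHomogeneousDerivation hLnil hn hα hαβ hco hLhom hL0 hL1
  -- At slope n + 1 the inequalities leave only the constant monomial in Du, and none divisible by v
  -- in Dv.
  have hle' : ∀ z ∈ S, z.2 * (n + 1) ≤ z.1 := fun z hz => by
    have := hle z hz
    rw [hβ, ← mul_assoc] at this
    exact le_of_mul_le_mul_right this hα
  refine ⟨fun s hs => ?_, fun s hs => ?_⟩
  · have h2 := hle' _ (mem0 s hs)
    simp only at h2
    have h3 := h0 s hs
    have h4 : s 1 = 0 := by
      by_contra h
      have := Nat.le_mul_of_pos_left (n + 1) (Nat.pos_of_ne_zero h)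
      rw [add_mul] at h2
      omega
    rw [h4] at h2
    exact ⟨by omega, h4⟩
  · by_contra h
    have h2 := hle' _ (mem1 s hs (Nat.pos_of_ne_zero h))
    simp only at h2
    have := Nat.le_mul_of_pos_left (n + 1) (Nat.pos_of_ne_zero h)
    omega

end Leading

/-! ### Linear changes of variables. -/

section Linear

variable {k σ : Type*} [Field k] [Fintype σ]

theorem derivation_eq_sum_pderiv (D : Derivation k (MvPolynomial σ k) (MvPolynomial σ k))
    (f : MvPolynomial σ k) : D f = ∑ i, pderiv i f * D (X i) := by
  classical
  induction f using MvPolynomial.induction_on with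
  | C a => simp
  | add f g hf hg => simp only [map_add, hf, hg, add_mul, Finset.sum_add_distrib]
  | mul_X f i hf =>
    simp only [Derivation.leibniz, hf, smul_eq_mul, pderiv_X, add_mul, Finset.sum_add_distrib,
      Finset.mul_sum, mul_assoc]
    congr 1
    rw [Finset.sum_eq_single i (fun j _ hj => by simp [Pi.single_eq_of_ne hj.symm]) (by simp)]
    simp

/-- The linear endomorphism of the polynomial ring given by a matrix. -/
noncomputable def linearHom (M : Matrix σ σ k) : MvPolynomial σ k →ₐ[k] MvPolynomial σ k :=
  aeval fun i => ∑ j, C (M i j) * X j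

theorem linearHom_comp (M N : Matrix σ σ k) :
    (linearHom N).comp (linearHom M) = linearHom (M * N) := by
  apply algHom_ext
  intro i
  simp only [linearHom, AlgHom.comp_apply, aeval_X, map_sum, map_mul, aeval_C, algebraMap_eq,
    Matrix.mul_apply, Finset.mul_sum, Finset.sum_mul]
  rw [Finset.sum_comm]
  simp only [mul_assoc]

theorem isHomogeneous_linearHom (M : Matrix σ σ k) {f : MvPolynomial σ k} {n : ℕ}
    (hf : f.IsHomogeneous n) : (linearHom M f).IsHomogeneous n := by
  have := hf.aeval (n := 1) (fun i => ∑ j, C (M i j) * X j) fun i =>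
    IsHomogeneous.sum _ _ _ fun j _ => (isHomogeneous_X k j).C_mul (M i j)
  rwa [one_mul] at this

theorem isHomogeneous_one_eq_sum {f : MvPolynomial σ k} (hf : f.IsHomogeneous 1) :
    f = ∑ i, C (coeff 0 (pderiv i f)) * X i := by
  have h1 := hf.sum_X_mul_pderiv
  rw [one_smul] at h1
  conv_lhs => rw [← h1]
  refine Finset.sum_congr rfl fun i _ => ?_
  have h2 := hf.pderiv (i := i)
  rw [← totalDegree_zero_iff_isHomogeneous, totalDegree_eq_zero_iff_eq_C] at h2
  conv_lhs => rw [h2]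
  rw [mul_comm]

variable [DecidableEq σ]

theorem linearHom_one : linearHom (1 : Matrix σ σ k) = AlgHom.id k _ := by
  apply algHom_ext
  intro i
  simp [linearHom, Matrix.one_apply, apply_ite C, ite_mul]

theorem exists_linear_automorphism (i j : σ) {c : σ → k} (hc : c j ≠ 0) :
    ∃ φ : MvPolynomial σ k ≃ₐ[k] MvPolynomial σ k, φ (X i) = ∑ l, C (c l) * X l ∧
      (∀ l, l ≠ i → l ≠ j → φ (X l) = X l) ∧
      (∀ (f : MvPolynomial σ k) (n : ℕ), f.IsHomogeneous n → (φ f).IsHomogeneous n) ∧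
      ∀ (f : MvPolynomial σ k) (n : ℕ), f.IsHomogeneous n → (φ.symm f).IsHomogeneous n := by
  -- The identity with row j replaced by c, then rows i and j exchanged; the determinant is ± c j.
  set M : Matrix σ σ k := ((1 : Matrix σ σ k).updateRow j c).submatrix (Equiv.swap i j) id with hM
  have hdet : IsUnit M.det := by
    rw [hM, Matrix.det_permute, ← Matrix.cramer_transpose_apply, Matrix.transpose_one,
      Matrix.cramer_one]
    refine IsUnit.mul ?_ (isUnit_iff_ne_zero.2 hc)
    exact (Units.isUnit (Equiv.Perm.sign (Equiv.swap i j))).map (Int.castRingHom k)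
  refine ⟨AlgEquiv.ofAlgHom (linearHom M) (linearHom M⁻¹) ?_ ?_, ?_, fun l hli hlj => ?_,
    fun f n hf => isHomogeneous_linearHom M hf, fun f n hf => isHomogeneous_linearHom M⁻¹ hf⟩
  · rw [linearHom_comp, Matrix.nonsing_inv_mul _ hdet, linearHom_one]
  · rw [linearHom_comp, Matrix.mul_nonsing_inv _ hdet, linearHom_one]
  · simp [linearHom, hM]
  · simp [linearHom, hM, Equiv.swap_apply_of_ne_of_ne hli hlj, Matrix.updateRow_ne hlj,
      Matrix.one_apply, apply_ite C, ite_mul]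

end Linear

/-! ### Invariance under automorphisms. -/

section Conjugation

variable {k B : Type*} [CommRing k] [CommRing B] [Algebra k B]

/-- The derivation `φ⁻¹ D φ`. -/
def conj (φ : B ≃ₐ[k] B) (D : Derivation k B B) : Derivation k B B :=
  Derivation.mk' (φ.symm.toLinearMap ∘ₗ D.toLinearMap ∘ₗ φ.toLinearMap) fun a b => by
    simp

theorem conj_apply (φ : B ≃ₐ[k] B) (D : Derivation k B B) (f : B) :
    conj φ D f = φ.symm (D (φ f)) := rfl

theorem IsLocallyNilpotent.conj {D : Derivation k B B} (hD : IsLocallyNilpotent D)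
    (φ : B ≃ₐ[k] B) : IsLocallyNilpotent (conj φ D) := by
  intro f
  obtain ⟨m, hm⟩ := hD (φ f)
  have key : ∀ m, (PolyDer.conj φ D)^[m] f = φ.symm (D^[m] (φ f)) := by
    intro m
    induction m with
    | zero => simp
    | succ m ih => rw [Function.iterate_succ_apply', ih, conj_apply, φ.apply_symm_apply,
        Function.iterate_succ_apply']
  exact ⟨m, by rw [key, hm, map_zero]⟩

theorem IsIrreducible.conj {D : Derivation k B B} (hD : IsIrreducible D)
    (φ : B ≃ₐ[k] B) : IsIrreducible (conj φ D) := by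
  intro b hb
  have h1 : IsUnit (φ b) := hD _ fun f => by
    have := map_dvd φ (hb (φ.symm f))
    rwa [conj_apply, φ.apply_symm_apply, φ.apply_symm_apply] at this
  simpa using h1.map φ.symm

theorem IsTriangularizable.of_conj
    {D : Derivation k (MvPolynomial (Fin 3) k) (MvPolynomial (Fin 3) k)}
    (φ : MvPolynomial (Fin 3) k ≃ₐ[k] MvPolynomial (Fin 3) k)
    (h : IsTriangularizable (PolyDer.conj φ D)) : IsTriangularizable D := by
  obtain ⟨x, hx, h0, h1, h2⟩ := h
  have hD : ∀ f, D (φ f) = φ (PolyDer.conj φ D f) := fun f => by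
    rw [conj_apply, φ.apply_symm_apply]
  have hmap : ∀ {S : Set (MvPolynomial (Fin 3) k)} {f : MvPolynomial (Fin 3) k},
      f ∈ Algebra.adjoin k S → φ f ∈ Algebra.adjoin k (φ '' S) := fun {S f} hf => by
    have : φ.toAlgHom f ∈ (Algebra.adjoin k S).map φ.toAlgHom := Subalgebra.mem_map.2 ⟨f, hf, rfl⟩
    rwa [AlgHom.map_adjoin] at this
  refine ⟨fun i => φ (x i), ?_, ?_, ?_, ?_⟩
  · have : (aeval fun i => φ (x i)) = φ.toAlgHom.comp (aeval x) := algHom_ext fun i => by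
      simp only [AlgHom.comp_apply, aeval_X]; rfl
    unfold IsSystemOfVariables
    rw [this]
    exact φ.bijective.comp hx
  · rw [hD, h0, map_zero]
  · rw [hD]
    simpa using hmap h1
  · rw [hD]
    simpa [Set.image_pair] using hmap h2

end Conjugation

/-! ### Setting the first variable to 0 or 1, and reduction to two variables. -/

section Specialization

variable {k : Type*} [Field k]

/-- Specialization of the first variable of `k[X₀, X₁, X₂]` to a constant. -/
noncomputable def specialize (ε : k) : MvPolynomial (Fin 3) k →ₐ[k] MvPolynomial (Fin 2) k :=
  aeval ![C ε, X 0, X 1]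

theorem specialize_eq_eval (ε : k) (f : MvPolynomial (Fin 3) k) :
    specialize ε f = (finSuccEquiv k 2 f).eval (C ε) := by
  have : specialize ε = (((Polynomial.aeval (C ε : MvPolynomial (Fin 2) k)).restrictScalars k).comp
      (finSuccEquiv k 2).toAlgHom) := by
    apply algHom_ext
    intro i
    refine Fin.cases ?_ (fun j => ?_) i
    · simp [specialize, finSuccEquiv_X_zero]
    · have := finSuccEquiv_X_succ (R := k) (j := j)
      fin_cases j <;> simp_all [specialize]
  rw [this]
  simp [Polynomial.coe_aeval_eq_eval]

theorem coeff_specialize_zero (f : MvPolynomial (Fin 3) k) (t : Fin 2 →₀ ℕ) :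
    coeff t (specialize 0 f) = coeff (t.cons 0) f := by
  rw [specialize_eq_eval, C_0, ← Polynomial.coeff_zero_eq_eval_zero, finSuccEquiv_coeff_coeff]

theorem X_dvd_of_specialize_zero {f : MvPolynomial (Fin 3) k} (h : specialize 0 f = 0) :
    X 0 ∣ f := by
  rw [specialize_eq_eval, C_0, ← Polynomial.coeff_zero_eq_eval_zero, ← Polynomial.X_dvd_iff,
    ← finSuccEquiv_X_zero] at h
  simpa using map_dvd (finSuccEquiv k 2).symm h

theorem coeff_specialize_one (f : MvPolynomial (Fin 3) k) (t : Fin 2 →₀ ℕ) :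
    coeff t (specialize 1 f) =
      ∑ i ∈ Finset.range ((finSuccEquiv k 2 f).natDegree + 1), coeff (t.cons i) f := by
  rw [specialize_eq_eval, C_1, Polynomial.eval_eq_sum_range, coeff_sum]
  simp [finSuccEquiv_coeff_coeff]

theorem isHomogeneous_sum_eq {f : MvPolynomial (Fin 3) k} {n : ℕ} (hf : f.IsHomogeneous n)
    {i : ℕ} {t : Fin 2 →₀ ℕ} (h : coeff (t.cons i) f ≠ 0) : i + (t 0 + t 1) = n := by
  have h1 := hf h
  rw [Finsupp.weight_apply, Finsupp.sum_fintype _ _ (by simp)] at h1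
  rw [Fin.sum_univ_succ, Fin.sum_univ_two, Finsupp.cons_zero, Finsupp.cons_succ,
    Finsupp.cons_succ] at h1
  simpa using h1

/-- Dehomogenizing is faithful: in a form of degree n the exponent of X₀ is determined by the other
two, so no terms merge. -/
theorem coeff_specialize_one_of_ne_zero {f : MvPolynomial (Fin 3) k} {n : ℕ}
    (hf : f.IsHomogeneous n) {i : ℕ} {t : Fin 2 →₀ ℕ} (h : coeff (t.cons i) f ≠ 0) :
    coeff t (specialize 1 f) = coeff (t.cons i) f := by
  rw [coeff_specialize_one]
  refine Finset.sum_eq_single i (fun j _ hj => ?_) fun hi => ?_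
  · by_contra h2
    have := isHomogeneous_sum_eq hf h
    have := isHomogeneous_sum_eq hf h2
    omega
  · rw [← finSuccEquiv_coeff_coeff, Polynomial.coeff_eq_zero_of_natDegree_lt, coeff_zero]
    simpa using hi

theorem exists_coeff_cons_ne_zero {f : MvPolynomial (Fin 3) k} {t : Fin 2 →₀ ℕ}
    (h : coeff t (specialize 1 f) ≠ 0) : ∃ i, coeff (t.cons i) f ≠ 0 := by
  rw [coeff_specialize_one] at h
  obtain ⟨i, -, hi⟩ := Finset.exists_ne_zero_of_sum_ne_zero h
  exact ⟨i, hi⟩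

theorem isHomogeneous_specialize_zero {f : MvPolynomial (Fin 3) k} {n : ℕ}
    (hf : f.IsHomogeneous n) : (specialize 0 f).IsHomogeneous n := by
  have := hf.aeval (n := 1) ![C (0 : k), X 0, X (1 : Fin 2)] (by
    intro i
    fin_cases i
    · simpa using isHomogeneous_zero _ _ _
    · exact isHomogeneous_X _ _
    · exact isHomogeneous_X _ _)
  rwa [one_mul] at this

/-- The derivation induced on `k[u, v]` by specializing the first variable. -/
noncomputable def specializeDerivation (ε : k)
    (D : Derivation k (MvPolynomial (Fin 3) k) (MvPolynomial (Fin 3) k)) :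
    Derivation k (MvPolynomial (Fin 2) k) (MvPolynomial (Fin 2) k) :=
  mkDerivation k fun j => specialize ε (D (X j.succ))

theorem specializeDerivation_X (ε : k)
    (D : Derivation k (MvPolynomial (Fin 3) k) (MvPolynomial (Fin 3) k)) (j : Fin 2) :
    specializeDerivation ε D (X j) = specialize ε (D (X j.succ)) :=
  mkDerivation_X _ _ _

theorem specialize_X_succ (ε : k) (j : Fin 2) : specialize ε (X j.succ) = X j := by
  fin_cases j <;> simp [specialize]

variable {D : Derivation k (MvPolynomial (Fin 3) k) (MvPolynomial (Fin 3) k)}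

theorem specialize_derivation (hD : D (X 0) = 0) (ε : k) (f : MvPolynomial (Fin 3) k) :
    specialize ε (D f) = specializeDerivation ε D (specialize ε f) := by
  have hX : ∀ i, specialize ε (D (X i)) = specializeDerivation ε D (specialize ε (X i)) := by
    intro i
    refine Fin.cases ?_ (fun j => ?_) i
    · rw [hD, map_zero]
      simp [specialize]
    · rw [specialize_X_succ, specializeDerivation_X]
  induction f using MvPolynomial.induction_on with
  | C a => simp [specialize, ← algebraMap_eq]
  | add f g hf hg => rw [map_add, map_add, map_add, map_add, hf, hg]
  | mul_X f i hf => simp [hf, hX]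

theorem isLocallyNilpotent_specializeDerivation (hnil : IsLocallyNilpotent D)
    (hD : D (X 0) = 0) (ε : k) : IsLocallyNilpotent (specializeDerivation ε D) := by
  refine isLocallyNilpotent_of_X fun j => ?_
  obtain ⟨m, hm⟩ := hnil (X j.succ)
  have key : ∀ m, (specializeDerivation ε D)^[m] (X j) = specialize ε (D^[m] (X j.succ)) := by
    intro m
    induction m with
    | zero => simp [specialize_X_succ]
    | succ m ih => rw [Function.iterate_succ_apply', ih, ← specialize_derivation hD,
        Function.iterate_succ_apply']
  exact ⟨m, by rw [key, hm, map_zero]⟩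

theorem mem_adjoin_image_X {σ : Type*} {S : Set σ} {f : MvPolynomial σ k}
    (h : ∀ s, coeff s f ≠ 0 → ∀ i ∉ S, s i = 0) : f ∈ Algebra.adjoin k (X '' S) := by
  rw [← supported_eq_adjoin_X, mem_supported]
  intro i hi
  obtain ⟨s, hs, his⟩ := mem_vars_iff_mem_support i |>.1 hi
  by_contra hiS
  exact Finsupp.mem_support_iff.1 his (h s (mem_support_iff.1 hs) i hiS)

theorem homogeneousComponent_derivation {q : ℕ}
    (hhom : ∀ (i : ℕ) (f : MvPolynomial (Fin 3) k), f.IsHomogeneous i →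
      (D f).IsHomogeneous (i + q)) (f : MvPolynomial (Fin 3) k) (m : ℕ) :
    homogeneousComponent (m + q) (D f) = D (homogeneousComponent m f) := by
  conv_lhs => rw [← sum_homogeneousComponent f]
  rw [map_sum, map_sum]
  have h1 : ∀ i, homogeneousComponent (m + q) (D (homogeneousComponent i f)) =
      if m = i then D (homogeneousComponent i f) else 0 := fun i => by
    rw [homogeneousComponent_of_mem (hhom i _ (homogeneousComponent_isHomogeneous i f))]
    simp
  simp only [h1, Finset.sum_ite_eq, Finset.mem_range]
  split_ifs with h
  · rfl
  · rw [homogeneousComponent_eq_zero _ _ (by omega), map_zero]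

variable [CharZero k]

/-- At X₀ = 0 the induced derivation kills u, so it sends v to a scalar multiple of uⁿ. At X₀ = 1
every other monomial has lost degree, which is the situation of the Newton polygon argument. The
original coordinates are then already triangular. -/
theorem isTriangularizable_of_specialize (hnil : IsLocallyNilpotent D) {n : ℕ}
    (hn : (n + 1).Prime) (hhom : ∀ i, (D (X i)).IsHomogeneous n) (h0 : D (X 0) = 0)
    (h1 : specialize 0 (D (X 1)) = 0) (h2 : specialize 0 (D (X 2)) ≠ 0) :
    IsTriangularizable D := by
  have hnil0 := isLocallyNilpotent_specializeDerivation hnil h0 0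
  have hnil1 := isLocallyNilpotent_specializeDerivation hnil h0 1
  have hs0 : ∀ ε : k, specializeDerivation ε D (X 0) = specialize ε (D (X 1)) :=
    fun ε => specializeDerivation_X ε D 0
  have hs1 : ∀ ε : k, specializeDerivation ε D (X 1) = specialize ε (D (X 2)) :=
    fun ε => specializeDerivation_X ε D 1
  have hv : ∀ t, coeff t (specialize 0 (D (X 2))) ≠ 0 → t 1 = 0 ∧ t 0 = n := by
    intro t ht
    have h3 : t 1 = 0 := by
      refine apply_one_eq_zero_of_coeff_ne_zero hnil0 (α := 1) (β := 1) (d := n) one_ne_zero ?_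
        (by rw [hs0, h1]) (by rwa [hs1])
      rw [hs1]
      exact isWeightedHomogeneous_one_iff.2 (isHomogeneous_specialize_zero (hhom 2))
    rw [coeff_specialize_zero] at ht
    have := isHomogeneous_sum_eq (hhom 2) ht
    exact ⟨h3, by omega⟩
  obtain ⟨hu', hv'⟩ := eq_zero_of_mem_support_of_isLocallyNilpotent hnil1 hn
    (fun t ht => by
      rw [hs0] at ht
      obtain ⟨i, hi⟩ := exists_coeff_cons_ne_zero ht
      have h3 := isHomogeneous_sum_eq (hhom 1) hi
      have h4 : i ≠ 0 := by
        rintro rfl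
        rw [← coeff_specialize_zero, h1, coeff_zero] at hi
        exact hi rfl
      omega)
    (fun t ht => by
      rw [hs1] at ht
      obtain ⟨i, hi⟩ := exists_coeff_cons_ne_zero ht
      have h3 := isHomogeneous_sum_eq (hhom 2) hi
      rcases Nat.eq_zero_or_pos i with rfl | h4
      · exact Or.inr (hv t (by rwa [coeff_specialize_zero]))
      · left; omega)
    (by
      obtain ⟨t, ht⟩ := exists_coeff_ne_zero h2
      obtain ⟨h3, h4⟩ := hv t ht
      have h5 : t = Finsupp.single 0 n := by
        ext i
        fin_cases i
        · simpa using h4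
        · simpa using h3
      rw [coeff_specialize_zero] at ht
      rw [hs1, ← h5, coeff_specialize_one_of_ne_zero (hhom 2) ht]
      exact ht)
  have hcons : ∀ {f : MvPolynomial (Fin 3) k}, f.IsHomogeneous n → ∀ {s}, coeff s f ≠ 0 →
      coeff s.tail (specialize 1 f) ≠ 0 := by
    intro f hf s hs
    rw [← s.cons_tail] at hs
    rwa [coeff_specialize_one_of_ne_zero hf hs]
  refine ⟨X, ?_, h0, ?_, ?_⟩
  · unfold IsSystemOfVariables
    rw [aeval_X_left]
    exact Function.bijective_id
  · have := mem_adjoin_image_X (S := {(0 : Fin 3)}) (f := D (X 1)) fun s hs i hi => by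
      obtain ⟨h3, h4⟩ := hu' s.tail (by rw [hs0]; exact hcons (hhom 1) hs)
      fin_cases i
      · simp at hi
      · exact h3
      · exact h4
    simpa using this
  · have := mem_adjoin_image_X (S := {(0 : Fin 3), 1}) (f := D (X 2)) fun s hs i hi => by
      have h3 := hv' s.tail (by rw [hs1]; exact hcons (hhom 2) hs)
      fin_cases i
      · simp at hi
      · simp at hi
      · exact h3
    simpa [Set.image_pair] using this

theorem isTriangularizable_of_X_mem_ker (hnil : IsLocallyNilpotent D) (hirr : IsIrreducible D)
    {n : ℕ} (hn : (n + 1).Prime)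
    (hhom : ∀ f : MvPolynomial (Fin 3) k, f.IsHomogeneous 1 → (D f).IsHomogeneous n)
    (h0 : D (X 0) = 0) : IsTriangularizable D := by
  have hnil0 := isLocallyNilpotent_specializeDerivation hnil h0 0
  have hn0 : 0 < n := by have := hn.two_le; omega
  obtain ⟨a, b, hab, hl⟩ := exists_linear_form hnil0 hn0 fun i => by
    rw [specializeDerivation_X]
    exact isHomogeneous_specialize_zero (hhom _ (isHomogeneous_X _ _))
  set l : MvPolynomial (Fin 3) k := C a * X 1 + C b * X 2 with hldef
  have hspl : specialize 0 l = C a * X 0 + C b * X 1 := by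
    simp [specialize, hldef, ← algebraMap_eq]
  rw [← hspl, ← specialize_derivation h0] at hl
  obtain ⟨j, hj0, hj⟩ : ∃ j : Fin 3, j ≠ 0 ∧ (![0, a, b] : Fin 3 → k) j ≠ 0 := by
    rcases hab with h | h
    · exact ⟨1, by simp, by simpa using h⟩
    · exact ⟨2, by simp, by simpa using h⟩
  obtain ⟨φ, hφ1, hφ, hφhom, hφhom'⟩ := exists_linear_automorphism 1 j hj
  have hφ1' : φ (X 1) = l := by rw [hφ1, Fin.sum_univ_three]; simp [hldef]
  have hφ0 : φ (X 0) = X 0 := hφ 0 (by simp) hj0.symm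
  have hφ0' : φ.symm (X 0) = X 0 := by rw [φ.symm_apply_eq, hφ0]
  have h0' : conj φ D (X 0) = 0 := by rw [conj_apply, hφ0, h0, map_zero]
  have h1' : X 0 ∣ conj φ D (X 1) := by
    have := map_dvd φ.symm (X_dvd_of_specialize_zero hl)
    rwa [hφ0', ← hφ1', ← conj_apply] at this
  refine IsTriangularizable.of_conj φ (isTriangularizable_of_specialize (hnil.conj φ) hn
    (fun i => hφhom' _ _ (hhom _ (hφhom _ _ (isHomogeneous_X _ _)))) h0' ?_ fun h2 => ?_)
  · obtain ⟨q, hq⟩ := h1'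
    rw [hq, map_mul]
    simp [specialize]
  -- Otherwise X₀ would divide the whole image of the derivation, against irreducibility.
  · have h2' := X_dvd_of_specialize_zero h2
    have hunit : IsUnit (X 0 : MvPolynomial (Fin 3) k) := hirr.conj φ _ fun f => by
      rw [derivation_eq_sum_pderiv, Fin.sum_univ_three, h0', mul_zero, zero_add]
      exact dvd_add (h1'.mul_left _) (h2'.mul_left _)
    have := hunit.map (aeval fun _ : Fin 3 => (0 : k))
    simp at this

/-- The derivation ∂/∂xᵢ of the new coordinates sends xᵢ to 1. By the chain rule the constant term
of that value is a combination of the linear coefficients of xᵢ, so these cannot all vanish. -/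
theorem homogeneousComponent_one_ne_zero {x : Fin 3 → MvPolynomial (Fin 3) k}
    (hx : IsSystemOfVariables x) (i : Fin 3) : homogeneousComponent 1 (x i) ≠ 0 := by
  intro h0
  set φ := AlgEquiv.ofBijective (aeval x) hx with hφ
  have hφX : φ (X i) = x i := aeval_X _ _
  have h1 : conj φ.symm (pderiv i) (x i) = 1 := by
    rw [conj_apply, ← hφX, φ.symm_apply_apply, pderiv_X_self, map_one]
  rw [derivation_eq_sum_pderiv] at h1
  have h2 := congrArg constantCoeff h1
  rw [map_sum, map_one, Finset.sum_eq_zero] at h2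
  · exact zero_ne_one h2
  · intro l _
    have h3 : coeff (Finsupp.single l 1) (homogeneousComponent 1 (x i)) = 0 := by
      rw [h0, coeff_zero]
    rw [coeff_homogeneousComponent, if_pos (by simp)] at h3
    rw [map_mul, constantCoeff_eq, coeff_pderiv, zero_add, h3, zero_mul, zero_mul]

end Specialization

end PolyDer

/-! ### From rank 2 to a linear form in the kernel. -/

theorem mainTheorem8 {k : Type*} [Field k] [CharZero k] (p : ℕ) (hp : p.Prime)
    (D : Derivation k (MvPolynomial (Fin 3) k) (MvPolynomial (Fin 3) k))
    (hnil : PolyDer.IsLocallyNilpotent D)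
    (hirr : PolyDer.IsIrreducible D)
    (hhom : PolyDer.IsHomogeneousOfDegree D ((p : ℤ) - 2))
    (hrank : PolyDer.rank D = 2) :
    PolyDer.IsTriangularizable D := by
  open PolyDer MvPolynomial in
  obtain ⟨q, rfl⟩ := Nat.exists_eq_add_of_le' hp.two_le
  have hhom' : ∀ (i : ℕ) (f : MvPolynomial (Fin 3) k), f.IsHomogeneous i →
      (D f).IsHomogeneous (i + q) := by
    intro i f hf
    rcases hhom i f hf with h | ⟨j, hj, h⟩
    · rw [h]; exact isHomogeneous_zero _ _ _
    · push_cast at hj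
      obtain rfl : j = i + q := by omega
      exact h
  obtain ⟨x, hx, hx2⟩ : 2 ∈ {r : ℕ | ∃ x : Fin 3 → MvPolynomial (Fin 3) k,
      IsSystemOfVariables x ∧ ∀ i : Fin 3, r ≤ (i : ℕ) → D (x i) = 0} := by
    -- The infimum of the empty set is 0, so a rank of 2 is attained.
    have := Nat.sInf_mem (Nat.nonempty_of_pos_sInf (by
      change 0 < PolyDer.rank D
      omega))
    rwa [show sInf _ = 2 from hrank] at this
  have hL0 := homogeneousComponent_one_ne_zero hx 2
  have hDL : D (homogeneousComponent 1 (x 2)) = 0 := by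
    rw [← homogeneousComponent_derivation hhom', hx2 2 le_rfl, map_zero]
  have hL := isHomogeneous_one_eq_sum (homogeneousComponent_isHomogeneous 1 (x 2))
  set L := homogeneousComponent 1 (x 2)
  obtain ⟨j, hj⟩ : ∃ j, coeff 0 (pderiv j L) ≠ 0 := by
    by_contra! h
    refine hL0 (hL.trans (Finset.sum_eq_zero fun i _ => ?_))
    rw [h i, C_0, zero_mul]
  obtain ⟨φ, hφ0, -, hφhom, hφhom'⟩ := exists_linear_automorphism 0 j
    (c := fun j => coeff 0 (pderiv j L)) hj
  rw [← hL] at hφ0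
  refine IsTriangularizable.of_conj φ (isTriangularizable_of_X_mem_ker (hnil.conj φ)
    (hirr.conj φ) (n := q + 1) hp (fun f hf => ?_) ?_)
  · rw [add_comm]
    exact hφhom' _ _ (hhom' _ _ (hφhom _ _ hf))
  · rw [conj_apply, hφ0, hDL, map_zero]
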